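/- Oracles are infinite binary sequences $A\in\{0,1\}^\omega$, also viewed as sets of natural numbers or (identifying the $(n+1)$-th binary string in length-lexicographic order with $n$) as languages. Oracle Turing machines are multitape machines with a query tape; an oracle query about the string on the query tape takes one step. A machine decides a language $L\subseteq\{0,1\}^*$ in time $f$ if on every input $x$ it halts within $f(x)$ steps with the correct answer to "$x\in L$?". An oracle $A$ is *low for speed* if for every computable language $L$, every oracle machine $M$ and every $f$ such that $M$ with oracle $A$ decides $L$ in time $f$, there are a machine $M'$ without oracle and a polynomial $p$ such that $M'$ decides $L$ in time $p\circ f$. Here time bounds $f$ are functions of the input $x\in\{0,1\}^*$; the theorem below is asserted both for this notion and for the (weaker) notion in which only bounds depending on the length $|x|$ are considered. Let $\mathsf{LFS}$ be the set of low for speed oracles and $\mathbf{LFS}$ the set of Turing degrees that contain a member of $\mathsf{LFS}$. A function $g:\mathbb N\to\mathbb N$ is *DNC* if $g(e)\neq\varphi_e(e)$ for every $e$ such that $\varphi_e(e)$ is defined, where $(\varphi_e)$ is the standard enumeration of the partial computable functions; a *DNC degree* is a Turing degree that computes a DNC function. A sequence $X\in\{0,1\}^\omega$ is *Martin-Löf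 random* if $X\notin\bigcap_n U_n$ for every sequence $(U_n)$ of uniformly computably enumerable open subsets of $\{0,1\}^\omega$ with $\lambda(U_n)\le 2^{-n}$ for all $n$, where $\lambda$ is the uniform measure. **Theorem.** 1. If $A\in\{0,1\}^\omega$ computes a DNC function, then $A$ is not low for speed; equivalently, if $\mathbf a$ is a DNC degree, then $\mathbf a\notin\mathbf{LFS}$. 2. Hence $\mathsf{LFS}$ and $\mathbf{LFS}$ are disjoint from a Turing upper cone: there is a $B\in\{0,1\}^\omega$ such that no $A\ge_T B$ is low for speed, and no degree $\mathbf a\ge\deg(B)$ is in $\mathbf{LFS}$. 3. If $A\in\{0,1\}^\omega$ computes a Martin-Löf random sequence, then $A$ is not low for speed; equivalently, if a degree $\mathbf a$ bounds the degree of a Martin-Löf random sequence, then $\mathbf a\notin\mathbf{LFS}$. -/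

import Mathlib

open scoped Computability

/-- The `(n+1)`-th binary string in length-lexicographic order is identified with `n`; this is the
number of a string (`[] ↦ 0`, `[0] ↦ 1`, `[1] ↦ 2`, `[0,0] ↦ 3`, ...). -/
def strNum (w : List Bool) : ℕ :=
  w.foldl (fun n b => 2 * n + 1 + b.toNat) 0

/-- What an oracle Turing machine may do in one step, in terms of its states `Q`, its tape
alphabet `Γ` and the index type `K` of its tapes. -/
inductive OracleAction (Q Γ K : Type) where
  /-- halt and output the bit `b` -/
  | halt (b : Bool)
  /-- on every tape write a symbol and move the head by at most one cell, possibly write one more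
  bit at the end of the query tape, and go to state `q` -/
  | go (q : Q) (write : K → Γ) (move : K → Option Turing.Dir) (emit : Option Bool)
  /-- ask the oracle about the string on the query tape, go to the state `q b` where `b` is the
  answer, and erase the query tape -/
  | query (q : Bool → Q)

/-- A deterministic multitape oracle Turing machine with a finite set of states `Q`, a finite tape
alphabet `Γ` (with blank symbol `default`, and with two different nonblank symbols `bit false` and
`bit true` used to write the input), `extraTapes + 1` two-way infinite read-write tapes, and a
query tape. Tape `0` initially holds the input. -/
structure OracleMachine where
  Q : Type
  [finiteQ : Finite Q]
  start : Q
  Γ : Type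
  [finiteΓ : Finite Γ]
  [blank : Inhabited Γ]
  bit : Bool → Γ
  bit_injective : Function.Injective bit
  bit_ne_blank : ∀ b, bit b ≠ default
  extraTapes : ℕ
  /-- the transition function, which reads the state and the symbols under the heads -/
  δ : Q → (Fin (extraTapes + 1) → Γ) → OracleAction Q Γ (Fin (extraTapes + 1))

namespace OracleMachine

attribute [instance] finiteQ finiteΓ blank

/-- A configuration: state, tapes with their heads, and contents of the query tape. -/
structure Cfg (M : OracleMachine) where
  state : M.Q
  tapes : Fin (M.extraTapes + 1) → Turing.Tape M.Γ
  queryTape : List Bool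

/-- The initial configuration on input `x`: the head of tape `0` scans the first symbol of `x`,
and all other tapes are blank. -/
def initial (M : OracleMachine) (x : List Bool) : M.Cfg where
  state := M.start
  tapes := fun i => Turing.Tape.mk₁ (if i = 0 then x.map M.bit else [])
  queryTape := []

/-- One step with oracle `A`: either a new configuration, or the output. Every step, including an
oracle query, takes one unit of time. -/
def step (M : OracleMachine) (A : ℕ → Bool) (c : M.Cfg) : M.Cfg ⊕ Bool :=
  match M.δ c.state (fun i => (c.tapes i).head) with
  | .halt b => .inr b
  | .go q write move emit => .inl
      { state := q
        tapes := fun i =>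
          match move i with
          | none => (c.tapes i).write (write i)
          | some d => ((c.tapes i).write (write i)).move d
        queryTape := c.queryTape ++ emit.toList }
  | .query q => .inl
      { state := q (A (strNum c.queryTape))
        tapes := c.tapes
        queryTape := [] }

/-- The output, if any, of `M` with oracle `A` run for at most `t` steps from a configuration. -/
def run (M : OracleMachine) (A : ℕ → Bool) : ℕ → M.Cfg → Option Bool
  | 0, _ => none
  | t + 1, c =>
    match M.step A c with
    | .inr b => some b
    | .inl c' => M.run A t c'

/-- With oracle `A`, the machine `M` decides the language `L` in time `f`: on every input `x`, it
halts after at most `f x` steps and its output tells whether `x ∈ L`. -/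
def DecidesInTime (M : OracleMachine) (A : ℕ → Bool) (L : Set (List Bool))
    (f : List Bool → ℕ) : Prop :=
  ∀ x, ∃ b : Bool, M.run A (f x) (M.initial x) = some b ∧ (b = true ↔ x ∈ L)

/-- A machine without oracle is one that never asks the oracle. -/
def OracleFree (M : OracleMachine) : Prop :=
  ∀ q s q', M.δ q s ≠ .query q'

end OracleMachine

/-- How time bounds are expressed: as functions of the input, or as functions of its length. -/
inductive TimeConvention where
  | perInput
  | perLength

/-- The time bounds allowed by a convention. -/
def TimeConvention.bounds : TimeConvention → Set (List Bool → ℕ)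
  | .perInput => Set.univ
  | .perLength => {f | ∃ g : ℕ → ℕ, f = fun x => g x.length}

/-- `A` is low for speed: whenever a computable language `L` is decided in time `f` by a machine
with oracle `A`, it is decided in time `p ∘ f`, for some polynomial `p`, by a machine without
oracle. -/
def LowForSpeed (c : TimeConvention) (A : ℕ → Bool) : Prop :=
  ∀ L : Set (List Bool), ComputablePred (· ∈ L) →
    ∀ f ∈ c.bounds, ∀ M : OracleMachine, M.DecidesInTime A L f →
      ∃ (M' : OracleMachine) (p : Polynomial ℕ), M'.OracleFree ∧
        M'.DecidesInTime (fun _ => false) L (fun x => p.eval (f x))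

/-- A total function on the natural numbers, as a partial function. -/
def totalFn (g : ℕ → ℕ) : ℕ →. ℕ := fun n => Part.some (g n)

/-- The characteristic function of an infinite binary sequence (a set of natural numbers). -/
def charFn (A : ℕ → Bool) : ℕ →. ℕ := totalFn fun n => (A n).toNat

/-- The Turing degree of a (partial) function. -/
def degree (g : ℕ →. ℕ) : TuringDegree := toAntisymmetrization TuringReducible g

/-- The order of Turing degrees is given by Turing reducibility. -/
theorem degree_le_degree_iff (g h : ℕ →. ℕ) : degree g ≤ degree h ↔ g ≤ᵀ h := Iff.rfl

/-- The Turing degrees that contain a low for speed set. -/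
def lfsDegrees (c : TimeConvention) : Set TuringDegree :=
  {a | ∃ A : ℕ → Bool, LowForSpeed c A ∧ degree (charFn A) = a}

/-- `g` is diagonally noncomputable: `g e ≠ φ_e(e)` for every `e` such that `φ_e(e)` is defined,
where `φ_e` is the `e`-th partial computable function. -/
def IsDNC (g : ℕ → ℕ) : Prop :=
  ∀ e : ℕ, g e ∉ (Denumerable.ofNat Nat.Partrec.Code e).eval e

/-- A DNC degree is one that computes a DNC function. -/
def IsDNCDegree (a : TuringDegree) : Prop :=
  ∃ g : ℕ → ℕ, IsDNC g ∧ degree (totalFn g) ≤ a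

/-- The set of infinite binary sequences that extend the finite string `σ`. -/
def cylinder (σ : List Bool) : Set (ℕ → Bool) :=
  {X | ∀ i, ∀ h : i < σ.length, X i = σ[i]}

/-- The uniform (fair coin) measure on infinite binary sequences. -/
noncomputable def coinMeasure : MeasureTheory.Measure (ℕ → Bool) :=
  MeasureTheory.Measure.infinitePi fun _ => ProbabilityTheory.uniformOn (Set.univ : Set Bool)

/-- `W` codes a Martin-Löf test: the open sets generated by the `W n` are uniformly computably
enumerable, and the `n`-th one has measure at most `2⁻ⁿ`. -/
def IsMLTest (W : ℕ → Set (List Bool)) : Prop :=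
  REPred (fun p : ℕ × List Bool => p.2 ∈ W p.1) ∧
    ∀ n, coinMeasure (⋃ σ ∈ W n, cylinder σ) ≤ (2⁻¹ : ENNReal) ^ n

/-- `X` is Martin-Löf random: it passes all Martin-Löf tests. -/
def MLRandom (X : ℕ → Bool) : Prop :=
  ∀ W, IsMLTest W → X ∉ ⋂ n, ⋃ σ ∈ W n, cylinder σ

/-! ### Runs of oracle machines -/

namespace OracleMachine

variable {M : OracleMachine} {A : ℕ → Bool}

/-! Let `g` be a DNC function computed by `A`. Inputs are the strings 1^m with m = ⟨⟨i, e⟩, ⟨v, t⟩⟩: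
i indexes a candidate fast algorithm, v is a guess for g(e), and t only makes m large. The language
consists of the 1^m with `ℓ m = true`, where `ℓ` is arranged so that membership implies φ_e(e) = v.
An oracle machine first tests whether the first m bits of `A` already yield g(e) = v
(`exists_approximates`). If they do, then v ≠ φ_e(e), and it rejects at once. Otherwise it computes
`ℓ m`, however long that takes.

The cost of the fast rejection has a computable bound h that depends on the test alone and not on
`ℓ` (`Cmd.exists_fast_machine`), so `ℓ` may be defined from h. Such a bound exists by compactness of
Cantor space: a test that halts with every oracle has, for each m, a time bound valid for all
oracles, and a search over finite pieces of oracle finds one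
(`OracleMachine.exists_computable_bound`).

If `A` were low for speed, an oracle-free machine would decide the language in time p ∘ f, hence
within p(h(m)) steps whenever the test succeeds. Its output after p(h(m)) steps is primitive
recursive in m and h(m), so it is the i-th entry of a total computable list
(`exists_universal_primrec`). In `exists_diagonal`, an index e = E(i) is chosen so that φ_e(e) is
the v of the least ⟨v, t⟩ at which this truncated simulation halts. Such a pair exists, because v =
g(e) with t large is one. At the least pair `ℓ` takes the opposite value to the simulation, and this
respects the constraint φ_e(e) = v. There v need not be g(e): any halting simulation must be
correct, which is a contradiction (`not_lowForSpeed_of_isDNC`).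

Oracle machines are obtained by compiling a small counter language. The upper cone is that above a
{0,1}-valued DNC function. A Martin-Löf random X yields a DNC function by mapping e to a code of its
first e + 1 bits, up to finitely many changes. -/

/-- In exactly `t` steps without halting, `M` with oracle `A` gets from one configuration to
another. -/
inductive Reaches (M : OracleMachine) (A : ℕ → Bool) : ℕ → M.Cfg → M.Cfg → Prop
  | refl (c) : Reaches M A 0 c c
  | head {t c c' c''} : M.step A c = .inl c' → Reaches M A t c' c'' → Reaches M A (t + 1) c c''

theorem Reaches.trans {s t : ℕ} {c c' c'' : M.Cfg} (h : M.Reaches A s c c')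
    (h' : M.Reaches A t c' c'') : M.Reaches A (s + t) c c'' := by
  induction h with
  | refl c => simpa using h'
  | head h₁ _ ih => rw [Nat.add_right_comm]; exact .head h₁ (ih h')

theorem Reaches.run_add {t : ℕ} {c c' : M.Cfg} (h : M.Reaches A t c c') (n : ℕ) :
    M.run A (t + n) c = M.run A n c' := by
  induction h with
  | refl c => simp
  | head h₁ _ ih => rw [Nat.add_right_comm, run, h₁]; exact ih

theorem Reaches.run_eq_none {t T : ℕ} {c c' : M.Cfg} (h : M.Reaches A t c c') (hT : T ≤ t) :
    M.run A T c = none := by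
  induction h generalizing T with
  | refl c => obtain rfl : T = 0 := by omega
              rfl
  | head h₁ _ ih =>
    cases T with
    | zero => rfl
    | succ T => rw [run, h₁]; exact ih (by omega)

theorem run_mono {s t : ℕ} (hst : s ≤ t) {c : M.Cfg} {b : Bool} (h : M.run A s c = some b) :
    M.run A t c = some b := by
  induction s generalizing t c with
  | zero => cases h
  | succ s ih =>
    obtain ⟨t, rfl⟩ : ∃ t', t = t' + 1 := ⟨t - 1, by omega⟩
    rw [run] at h ⊢
    split at h
    · exact h
    · exact ih (by omega) h

theorem run_unique {s t : ℕ} {c : M.Cfg} {b b' : Bool} (h : M.run A s c = some b)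
    (h' : M.run A t c = some b') : b = b' := by
  have h₁ := run_mono (le_max_left s t) h
  rw [run_mono (le_max_right s t) h'] at h₁
  exact (Option.some.inj h₁).symm

end OracleMachine

/-! ### A programming language with counters and an oracle -/

/-- Programs acting on registers that hold natural numbers, and on a query string. -/
inductive Cmd
  | inc (r : ℕ)
  | dec (r : ℕ)
  | emit (b : Bool)
  | ask (r : ℕ)
  | seq (a b : Cmd)
  | loop (r : ℕ) (a : Cmd)

namespace Cmd

/-- What remains to be executed after one step, depending on a bit: the answer of the oracle, or
whether a loop is entered. -/
def next : List Cmd → Bool → List Cmd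
  | [], _ => []
  | inc _ :: k, _ => k
  | dec _ :: k, _ => k
  | emit _ :: k, _ => k
  | ask r :: k, b => if b then inc r :: k else k
  | seq a b :: k, _ => a :: b :: k
  | loop r a :: k, b => if b then a :: loop r a :: k else k

theorem next_append {l : List Cmd} (hl : l ≠ []) (k : List Cmd) (b : Bool) :
    next (l ++ k) b = next l b ++ k := by
  match l with
  | inc _ :: _ | dec _ :: _ | emit _ :: _ | seq _ _ :: _ => rfl
  | ask r :: _ | loop r _ :: _ => cases b <;> rfl

/-- The registers that a program mentions are below this bound. -/
def bound : Cmd → ℕ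
  | inc r | dec r | ask r => r + 1
  | emit _ => 0
  | seq a b => max a.bound b.bound
  | loop r a => max (r + 1) a.bound

/-- Only finitely many continuations occur when a program is executed. -/
theorem exists_finite_closed (c : Cmd) : ∃ S : Set (List Cmd), S.Finite ∧ [c] ∈ S ∧ [] ∈ S ∧
    (∀ l ∈ S, ∀ b, next l b ∈ S) ∧ ∀ l ∈ S, ∀ a ∈ l, a.bound ≤ c.bound := by
  induction c with
  | inc r | dec r | emit r =>
    refine ⟨{[_], []}, by simp, .inl rfl, .inr rfl, ?_, ?_⟩
    · rintro l (rfl | rfl) b <;> exact .inr rfl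
    · rintro l (rfl | rfl) <;> simp
  | ask r =>
    refine ⟨{[ask r], [inc r], []}, by simp, by simp, by simp, ?_, ?_⟩
    · rintro l (rfl | rfl | rfl) b <;> cases b <;> simp [next]
    · rintro l (rfl | rfl | rfl) <;> simp [bound]
  | seq a b iha ihb =>
    obtain ⟨S, hS, ha, -, hn, hb⟩ := iha
    obtain ⟨T, hT, hbT, h0, hn', hb'⟩ := ihb
    -- While `a` is executed, `b` waits at the bottom of the stack. When the part belonging to `a`
    -- is exhausted, what remains is `[b]`, which lies in `T`.
    refine ⟨{[seq a b]} ∪ (· ++ [b]) '' S ∪ T,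
      ((Set.finite_singleton _).union (hS.image _)).union hT, by simp, .inr h0, ?_, ?_⟩
    · rintro l ((rfl | ⟨l, hl, rfl⟩) | hl) d
      · exact .inl (.inr ⟨_, ha, rfl⟩)
      · by_cases h : l = []
        · subst h; exact .inr (hn' _ hbT d)
        · exact .inl (.inr ⟨_, hn _ hl d, (next_append h _ _).symm⟩)
      · exact .inr (hn' _ hl d)
    · rintro l ((rfl | ⟨l, hl, rfl⟩) | hl) d hd
      · simp_all
      · rcases List.mem_append.1 hd with hd | hd
        · exact (hb l hl d hd).trans (le_max_left _ _)
        · simp only [List.mem_singleton] at hd; subst hd; exact le_max_right _ _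
      · exact (hb' l hl d hd).trans (le_max_right _ _)
  | loop r a ih =>
    obtain ⟨S, hS, ha, h0, hn, hb⟩ := ih
    refine ⟨{[]} ∪ (· ++ [loop r a]) '' S,
      (Set.finite_singleton _).union (hS.image _), .inr ⟨_, h0, rfl⟩, .inl rfl, ?_, ?_⟩
    · rintro l (rfl | ⟨l, hl, rfl⟩) d
      · exact .inl rfl
      · by_cases h : l = []
        · subst h
          cases d
          · exact .inl rfl
          · exact .inr ⟨_, ha, rfl⟩
        · exact .inr ⟨_, hn _ hl d, (next_append h _ _).symm⟩
    · rintro l (rfl | ⟨l, hl, rfl⟩) d hd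
      · simp at hd
      · rcases List.mem_append.1 hd with hd | hd
        · exact (hb l hl d hd).trans (le_max_right _ _)
        · simp only [List.mem_singleton] at hd; subst hd; exact le_rfl

/-- A state of the execution of a program. -/
structure St where
  todo : List Cmd
  reg : ℕ → ℕ
  query : List Bool

/-- One step of the execution of a program. -/
def step (A : ℕ → Bool) : St → St
  | ⟨[], s, w⟩ => ⟨[], s, w⟩
  | ⟨inc r :: k, s, w⟩ => ⟨k, Function.update s r (s r + 1), w⟩
  | ⟨dec r :: k, s, w⟩ => ⟨k, Function.update s r (s r - 1), w⟩
  | ⟨emit b :: k, s, w⟩ => ⟨k, s, w ++ [b]⟩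
  | ⟨ask r :: k, s, w⟩ => ⟨next (ask r :: k) (A (strNum w)), s, []⟩
  | ⟨seq a b :: k, s, w⟩ => ⟨a :: b :: k, s, w⟩
  | ⟨loop r a :: k, s, w⟩ => ⟨next (loop r a :: k) (s r != 0), s, w⟩

/-- In exactly `t` steps, none of them in a state where nothing remains to be done, the execution
gets from one state to another. -/
inductive Reaches (A : ℕ → Bool) : ℕ → St → St → Prop
  | refl (p) : Reaches A 0 p p
  | head {t p q} : p.todo ≠ [] → Reaches A t (step A p) q → Reaches A (t + 1) p q

theorem Reaches.trans {A : ℕ → Bool} {t u : ℕ} {p q r : St} (h : Reaches A t p q)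
    (h' : Reaches A u q r) : Reaches A (t + u) p r := by
  induction h with
  | refl p => simpa using h'
  | head hp _ ih => rw [Nat.add_right_comm]; exact .head hp (ih h')

/-! ### Compiling counter programs to multitape machines -/

/-- The tape that represents the content `n` of a register: all cells are blank except for a marker,
and the head is `n` cells to the right of the marker. -/
def regTape (n : ℕ) : Turing.Tape (Option Bool) :=
  (Turing.Tape.move .right)^[n] (Turing.Tape.mk₁ [some true])

theorem regTape_move_right (n : ℕ) : (regTape n).move .right = regTape (n + 1) :=
  (Function.iterate_succ_apply' _ _ _).symm

theorem regTape_move_left (n : ℕ) : (regTape (n + 1)).move .left = regTape n := by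
  rw [← regTape_move_right, Turing.Tape.move_right_left]

theorem regTape_head (n : ℕ) : (regTape n).head = if n = 0 then some true else none := by
  rw [regTape, Turing.Tape.move_right_n_head]
  cases n with
  | zero => rfl
  | succ n => cases n <;> rfl

theorem regTape_zero_write : (regTape 0).write (some true) = regTape 0 := rfl

theorem regTape_succ_write (n : ℕ) : (regTape (n + 1)).write none = regTape (n + 1) := by
  have := Turing.Tape.write_self (regTape (n + 1))
  rwa [regTape_head] at this

/-- The control states of the machine that executes a program. -/
inductive Ctrl (S : Set (List Cmd))
  | init
  | read
  | exec (l : S)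

instance (S : Set (List Cmd)) [Finite S] : Finite (Ctrl S) :=
  Finite.of_injective (β := Option (Option S))
    (fun | .init => none | .read => some none | .exec l => some (some l)) <| by
    rintro (_ | _ | _) (_ | _ | _) <;> simp

/-- The content of a cell of the tape that represents the register `r`. -/
def regSym {n : ℕ} (syms : Fin (n + 1) → Option Bool) (r : ℕ) : Option Bool :=
  if h : r + 1 < n + 1 then syms ⟨r + 1, h⟩ else none

open OracleAction in
/-- The transition function of the machine that executes a program: it marks the origin of the tapes
of the registers, reads the length of the input into register `0`, halts with output `false` when
the input is not a sequence of ones, executes the program, and outputs whether the content of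
register `1` is positive. -/
def trans (S : Set (List Cmd)) (hS : ∀ l ∈ S, ∀ b, next l b ∈ S) (c : S) (n : ℕ) :
    Ctrl S → (Fin (n + 1) → Option Bool) → OracleAction (Ctrl S) (Option Bool) (Fin (n + 1))
  | .init, x => go .read (fun i => if i = 0 then x 0 else some true) (fun _ => none) none
  | .read, x =>
    match x 0 with
    -- Tape 0 is the input and tape 1 is register `0`. Moving both heads together counts the ones.
    | some true => go .read x (fun i => if i.1 ≤ 1 then some .right else none) none
    | some false => halt false
    | none => go (.exec c) x (fun _ => none) none
  | .exec l, x =>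
    let q (b : Bool) : Ctrl S := .exec ⟨next l b, hS l l.2 b⟩
    match l.1 with
    | [] => halt (regSym x 1 != some true)
    | inc r :: _ => go (q true) x (fun i => if i.1 = r + 1 then some .right else none) none
    -- At the marker the head stays put, which realizes truncated subtraction.
    | dec r :: _ => go (q true) x
        (fun i => if i.1 = r + 1 ∧ x i ≠ some true then some .left else none) none
    | emit b :: _ => go (q true) x (fun _ => none) (some b)
    | ask _ :: _ => query q
    | seq _ _ :: _ => go (q true) x (fun _ => none) none
    | loop r _ :: _ => go (q (regSym x r != some true)) x (fun _ => none) none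

/-- The machine that executes a program. -/
abbrev machine (S : Set (List Cmd)) (hf : S.Finite) (hS : ∀ l ∈ S, ∀ b, next l b ∈ S) (c : S) (n : ℕ) :
    OracleMachine where
  Q := Ctrl S
  finiteQ := have := hf.to_subtype; inferInstance
  start := .init
  Γ := Option Bool
  bit := some
  bit_injective := Option.some_injective _
  bit_ne_blank := by simp [default]
  extraTapes := n
  δ := trans S hS c n

theorem ite_bne (n : ℕ) : ((if n = 0 then some true else none) != some true) = (n != 0) := by
  cases n <;> rfl

section Simulation

variable {S : Set (List Cmd)} {hf : S.Finite} {hS : ∀ l ∈ S, ∀ b, next l b ∈ S} {c : S} {n : ℕ}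

/-- A configuration represents a state of the execution of a program. -/
structure Represents (x : (machine S hf hS c n).Cfg) (p : St) : Prop where
  state : ∃ h, x.state = .exec ⟨p.todo, h⟩
  tapes : ∀ i : Fin n, x.tapes i.succ = regTape (p.reg i)
  query : x.queryTape = p.query

theorem Represents.regSym {x : (machine S hf hS c n).Cfg} {p : St} (h : Represents x p) {r : ℕ}
    (hr : r < n) : regSym (fun i => (x.tapes i).head) r = if p.reg r = 0 then some true else none := by
  rw [Cmd.regSym, dif_pos (Nat.succ_lt_succ hr)]
  have := h.tapes ⟨r, hr⟩
  rw [Fin.succ_mk] at this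
  rw [← regTape_head]
  exact congrArg _ this

/-- The simulation is step for step, with no overhead, so exact running times of programs carry over
to the machine. The bound on the registers guarantees that a loop reads an existing tape. -/
theorem Represents.step {x : (machine S hf hS c n).Cfg} {p : St} (h : Represents x p)
    (hn : ∀ a ∈ p.todo, a.bound ≤ n) (hp : p.todo ≠ []) (A : ℕ → Bool) :
    ∃ y, (machine S hf hS c n).step A x = .inl y ∧ Represents y (step A p) := by
  obtain ⟨⟨hl, hst⟩, ht, hq⟩ := id h
  obtain ⟨q, T, w⟩ := x
  obtain ⟨l, s, w'⟩ := p
  dsimp only at hl hst ht hq hp hn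
  subst hq hst
  match l, hp with
  | inc r :: k, _ =>
    refine ⟨_, rfl, ⟨_, rfl⟩, fun i => ?_, by simp [Cmd.step]⟩
    by_cases hi : (i : ℕ) = r
    · subst hi
      simp [Cmd.step, ht, regTape_move_right]
    · simp [Cmd.step, ht, hi]
  | dec r :: k, _ =>
    refine ⟨_, rfl, ⟨_, rfl⟩, fun i => ?_, by simp [Cmd.step]⟩
    by_cases hi : (i : ℕ) = r
    · subst hi
      rcases h0 : s i with _ | m
      · simp [Cmd.step, ht, h0, regTape_head, regTape_zero_write]
      · simp [Cmd.step, ht, h0, regTape_head, regTape_succ_write, regTape_move_left]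
    · simp [Cmd.step, ht, hi]
  | emit b :: k, _ =>
    exact ⟨_, rfl, ⟨_, rfl⟩, fun i => by simp [Cmd.step, ht], by simp [Cmd.step]⟩
  | ask r :: k, _ =>
    exact ⟨_, rfl, ⟨_, rfl⟩, fun i => by simp [Cmd.step, ht], by simp [Cmd.step]⟩
  | seq a b :: k, _ =>
    exact ⟨_, rfl, ⟨_, rfl⟩, fun i => by simp [Cmd.step, ht], by simp [Cmd.step]⟩
  | loop r a :: k, _ =>
    have hr : r + 1 ≤ n := (le_max_left _ _).trans (hn (loop r a) (by simp))
    have hsym := h.regSym (r := r) hr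
    dsimp only at hsym
    have hb : (Cmd.regSym (fun i => (T i).head) r != some true) = (s r != 0) :=
       (congrArg (· != some true) hsym).trans (ite_bne _)
    refine ⟨_, rfl, ⟨hS _ hl _, ?_⟩, fun i => by simp [Cmd.step, ht], by simp [Cmd.step]⟩
    simp only [Cmd.step, ← hb]

theorem Represents.reaches (hn : ∀ l ∈ S, ∀ a ∈ l, a.bound ≤ n) {A : ℕ → Bool} {t : ℕ}
    {x : (machine S hf hS c n).Cfg} {p q : St} (h : Represents x p) (hpq : Reaches A t p q) :
    ∃ y, (machine S hf hS c n).Reaches A t x y ∧ Represents y q := by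
  induction hpq generalizing x with
  | refl p => exact ⟨x, .refl x, h⟩
  | head hp _ ih =>
    obtain ⟨y, hy, hy'⟩ := h.step (hn _ h.state.1) hp A
    obtain ⟨z, hz, hz'⟩ := ih hy'
    exact ⟨z, .head hy hz, hz'⟩

/-- The registers hold `j, 0, 0, ...` -/
def inputReg (j : ℕ) : ℕ → ℕ := Function.update (fun _ => 0) 0 j

/-- A configuration in which the machine has already read `j` symbols of the input, and the symbols
`R` are left. -/
structure Reading (x : (machine S hf hS c n).Cfg) (j : ℕ) (R : List Bool) : Prop where
  state : x.state = .read
  input : ∃ L, x.tapes 0 = Turing.Tape.mk₂ L (R.map some)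
  tapes : ∀ i : Fin n, x.tapes i.succ = regTape (inputReg j i)
  query : x.queryTape = []

theorem reading_of_initial (A : ℕ → Bool) (w : List Bool) :
    ∃ x, (machine S hf hS c n).step A ((machine S hf hS c n).initial w) = .inl x ∧
      Reading x 0 w := by
  refine ⟨_, rfl, rfl, ⟨[], ?_⟩, fun i => ?_, rfl⟩
  · simp [OracleMachine.initial, Turing.Tape.mk₁]
  · have : inputReg 0 i = 0 := by simp [inputReg]
    rw [this]
    simp [OracleMachine.initial, Fin.succ_ne_zero]
    rfl

theorem Reading.step_true {x : (machine S hf hS c n).Cfg} {j : ℕ} {R : List Bool}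
    (h : Reading x j (true :: R)) (A : ℕ → Bool) :
    ∃ y, (machine S hf hS c n).step A x = .inl y ∧ Reading y (j + 1) R := by
  obtain ⟨q, T, w⟩ := x
  obtain ⟨hq, ⟨L, hL⟩, ht, hw⟩ := h
  dsimp only at hq hL ht hw
  subst hq hw
  have h0 : (T 0).head = some true := by rw [hL]; rfl
  refine ⟨⟨.read, fun i => if i.1 ≤ 1 then (T i).move .right else T i, []⟩, ?_, rfl,
    ⟨some true :: L, ?_⟩, fun i => ?_, rfl⟩
  · simp only [OracleMachine.step, trans, h0]
    congr 2
    · funext i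
      by_cases hi : i.1 ≤ 1 <;> simp [hi]
  · simp only [Fin.val_zero, zero_le, if_true, hL]
    rfl
  · by_cases hi : i.1 = 0
    · simp [hi, ht, inputReg, regTape_move_right]
    · simp [hi, ht, inputReg]

theorem Reading.run_false {x : (machine S hf hS c n).Cfg} {j : ℕ} {R : List Bool}
    (h : Reading x j R) (hR : false ∈ R) (A : ℕ → Bool) :
    (machine S hf hS c n).run A R.length x = some false := by
  induction R generalizing x j with
  | nil => simp at hR
  | cons b R ih =>
    cases b with
    | true =>
      obtain ⟨y, hy, hy'⟩ := h.step_true A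
      rw [List.length_cons, OracleMachine.run, hy]
      exact ih hy' (by simpa using hR)
    | false =>
      obtain ⟨q, T, w⟩ := x
      obtain ⟨hq, ⟨L, hL⟩, ht, hw⟩ := h
      dsimp only at hq hL
      subst hq
      have h0 : (T 0).head = some false := by rw [hL]; rfl
      rw [List.length_cons, OracleMachine.run]
      simp only [OracleMachine.step, trans, h0]

theorem Reading.reaches {x : (machine S hf hS c n).Cfg} {j m : ℕ}
    (h : Reading x j (List.replicate m true)) (A : ℕ → Bool) :
    ∃ y, (machine S hf hS c n).Reaches A (m + 1) x y ∧ Represents y ⟨c, inputReg (j + m), []⟩ := by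
  induction m generalizing x j with
  | zero =>
    obtain ⟨q, T, w⟩ := x
    obtain ⟨hq, ⟨L, hL⟩, ht, hw⟩ := h
    dsimp only at hq hL ht hw
    subst hq hw
    have h0 : (T 0).head = none := by rw [hL]; rfl
    refine ⟨⟨.exec c, T, []⟩, .head ?_ (.refl _), ⟨c.2, rfl⟩, ht, rfl⟩
    simp only [OracleMachine.step, trans, h0]
    congr 2
  | succ m ih =>
    obtain ⟨y, hy, hy'⟩ := h.step_true A
    obtain ⟨z, hz, hz'⟩ := ih hy'
    exact ⟨z, .head hy hz, by rwa [Nat.add_right_comm, Nat.add_assoc] at hz'⟩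

end Simulation

/-- In exactly `t` steps the execution of `c` changes the contents of the registers from `s` to `s'`
and the query string from `w` to `w'`. -/
def Exec (A : ℕ → Bool) (c : Cmd) (s : ℕ → ℕ) (w : List Bool) (s' : ℕ → ℕ) (w' : List Bool)
    (t : ℕ) : Prop :=
  ∀ k, Reaches A t ⟨c :: k, s, w⟩ ⟨k, s', w'⟩

/-- The machine that executes a program that leaves nothing on the query tape. -/
theorem exists_machine (c : Cmd) : ∃ M : OracleMachine, ∀ A : ℕ → Bool,
    (∀ w : List Bool, false ∈ w → M.run A (w.length + 1) (M.initial w) = some false) ∧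
    ∀ (m t : ℕ) (s : ℕ → ℕ), Exec A c (inputReg m) [] s [] t →
      M.run A (m + t + 2) (M.initial (List.replicate m true)) = none ∧
      M.run A (m + t + 3) (M.initial (List.replicate m true)) = some (s 1 != 0) := by
  obtain ⟨S, hf, hc, -, hS, hb⟩ := exists_finite_closed c
  -- The summand 2 ensures that register `1`, which is read at the end, has a tape even if the
  -- program never mentions it.
  refine ⟨machine S hf hS ⟨_, hc⟩ (c.bound + 2), fun A => ⟨fun w hw => ?_, fun m t s h => ?_⟩⟩
  · obtain ⟨x, hx, hx'⟩ := reading_of_initial (hf := hf) (hS := hS) (c := ⟨_, hc⟩) (n := c.bound + 2)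
      A w
    rw [OracleMachine.run, hx]
    exact hx'.run_false hw A
  · obtain ⟨x, hx, hx'⟩ := reading_of_initial (hf := hf) (hS := hS) (c := ⟨_, hc⟩) (n := c.bound + 2)
      A (List.replicate m true)
    obtain ⟨y, hy, hy'⟩ := hx'.reaches A
    rw [zero_add] at hy'
    obtain ⟨z, hz, hz'⟩ := hy'.reaches (fun l hl a ha => (hb l hl a ha).trans (by omega)) (h [])
    have hrun : (machine S hf hS ⟨_, hc⟩ (c.bound + 2)).run A 1 z = some (s 1 != 0) := by
      have hsym := hz'.regSym (r := 1) (by omega)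
      obtain ⟨⟨hl, hst⟩, -, -⟩ := hz'
      obtain ⟨q, T, w⟩ := z
      dsimp only at hst hsym
      subst hst
      refine congrArg some ?_
      exact (congrArg (· != some true) hsym).trans (ite_bne _)
    -- One step marks the origins, m + 1 steps read the input, and t steps execute the program. The
    -- halting step comes right after these m + t + 2.
    have hR := (OracleMachine.Reaches.head hx hy).trans hz
    refine ⟨hR.run_eq_none (by omega), ?_⟩
    rw [← hrun, ← hR.run_add 1]
    congr 1
    omega

end Cmd

/-! ### Counter programs for primitive recursive functions -/

namespace Cmd

open Function (update)

variable {A : ℕ → Bool} {a b : Cmd} {s s' s'' : ℕ → ℕ} {w w' w'' : List Bool} {r t u : ℕ}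

theorem exec_inc : Exec A (inc r) s w (update s r (s r + 1)) w 1 :=
  fun _ => .head (by simp) (.refl _)

theorem exec_dec : Exec A (dec r) s w (update s r (s r - 1)) w 1 :=
  fun _ => .head (by simp) (.refl _)

theorem exec_emit {d : Bool} : Exec A (emit d) s w s (w ++ [d]) 1 :=
  fun _ => .head (by simp) (.refl _)

theorem Exec.seq (ha : Exec A a s w s' w' t) (hb : Exec A b s' w' s'' w'' u) :
    Exec A (seq a b) s w s'' w'' (t + u + 1) :=
  fun k => .head (by simp) ((ha (b :: k)).trans (hb k))

theorem exec_loop_zero (h : s r = 0) : Exec A (loop r a) s w s w 1 := by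
  refine fun k => .head (by simp) ?_
  simp only [step, h]
  exact .refl _

theorem Exec.loop (h : s r ≠ 0) (ha : Exec A a s w s' w' t)
    (hb : Exec A (loop r a) s' w' s'' w'' u) : Exec A (loop r a) s w s'' w'' (t + u + 1) := by
  refine fun k => .head (by simp) ?_
  have : (s r != 0) = true := by simpa
  simp only [step, this]
  exact (ha _).trans (hb k)

/-- The execution of `c` terminates and changes the contents of the registers from `s` to `s'`
and the query string from `w` to `w'`. -/
def Runs (A : ℕ → Bool) (c : Cmd) (s : ℕ → ℕ) (w : List Bool) (s' : ℕ → ℕ) (w' : List Bool) :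
    Prop :=
  ∃ t, Exec A c s w s' w' t

theorem runs_inc : Runs A (inc r) s w (update s r (s r + 1)) w := ⟨_, exec_inc⟩

theorem runs_dec : Runs A (dec r) s w (update s r (s r - 1)) w := ⟨_, exec_dec⟩

theorem runs_emit {d : Bool} : Runs A (emit d) s w s (w ++ [d]) := ⟨_, exec_emit⟩

theorem runs_ask : Runs A (ask r) s w (update s r (s r + (A (strNum w)).toNat)) [] := by
  rcases h : A (strNum w) with _ | _
  · refine ⟨1, fun k => .head (by simp) ?_⟩
    simp only [step, h, next]
    simp only [Bool.toNat_false, add_zero, Function.update_eq_self]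
    exact .refl _
  · refine ⟨2, fun k => .head (by simp) ?_⟩
    simp only [step, h, next]
    exact .head (by simp) (.refl _)

theorem Runs.seq (ha : Runs A a s w s' w') (hb : Runs A b s' w' s'' w'') :
    Runs A (seq a b) s w s'' w'' :=
  let ⟨_, ha⟩ := ha
  let ⟨_, hb⟩ := hb
  ⟨_, ha.seq hb⟩

theorem Runs.congr (ha : Runs A a s w s' w') (h : s' = s'') : Runs A a s w s'' w' := h ▸ ha

/-- `S i` and `W i` are the loop invariant: the registers and the query string after `i` rounds. -/
theorem runs_loop {S : ℕ → ℕ → ℕ} {W : ℕ → List Bool} (n : ℕ) (h : ∀ i < n, S i r ≠ 0)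
    (h0 : S n r = 0) (ha : ∀ i < n, Runs A a (S i) (W i) (S (i + 1)) (W (i + 1))) :
    Runs A (loop r a) (S 0) (W 0) (S n) (W n) := by
  induction n generalizing S W with
  | zero => exact ⟨_, exec_loop_zero h0⟩
  | succ n ih =>
    obtain ⟨_, h₁⟩ := ha 0 (by omega)
    obtain ⟨_, h₂⟩ := ih (S := fun i => S (i + 1)) (W := fun i => W (i + 1))
      (fun i hi => h _ (by omega)) h0 (fun i hi => ha _ (by omega))
    exact ⟨_, .loop (h 0 (by omega)) h₁ h₂⟩

theorem runs_clear : Runs A (loop r (dec r)) s w (update s r 0) w := by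
  refine ((runs_loop (S := fun i => update s r (s r - i)) (W := fun _ => w) (s r) (fun i hi => ?_)
    (by simp) (fun i hi => ?_)).congr (by simp)).congr rfl |> fun h => by simpa using h
  · simp; omega
  · exact runs_dec.congr (by simp [Nat.sub_sub])

/-- Add the content of the register `a` to the register `b` and clear `a`. -/
def move (a b : ℕ) : Cmd := loop a (seq (dec a) (inc b))

theorem runs_move {a b : ℕ} (hab : a ≠ b) :
    Runs A (move a b) s w (update (update s b (s b + s a)) a 0) w := by
  have := runs_loop (A := A) (a := seq (dec a) (inc b)) (r := a)
    (S := fun i => update (update s b (s b + i)) a (s a - i)) (W := fun _ => w) (s a)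
    (fun i hi => by simp; omega) (by simp)
    (fun i hi => (runs_dec.seq runs_inc).congr <| by
      funext x
      simp only [Function.update_apply]
      split_ifs <;> omega)
  simpa [move] using this

/-- Add the content of the register `a` to the register `b`, using an empty register `c`. -/
def copy (a b c : ℕ) : Cmd := seq (loop a (seq (dec a) (seq (inc b) (inc c)))) (move c a)

theorem runs_copy {a b c : ℕ} (hab : a ≠ b) (hac : a ≠ c) (hbc : b ≠ c) (hc : s c = 0) :
    Runs A (copy a b c) s w (update s b (s b + s a)) w := by
  have := runs_loop (A := A) (a := seq (dec a) (seq (inc b) (inc c))) (r := a)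
    (S := fun i => update (update (update s b (s b + i)) c i) a (s a - i)) (W := fun _ => w) (s a)
    (fun i hi => by simp; omega) (by simp)
    (fun i hi => (runs_dec.seq (runs_inc.seq runs_inc)).congr <| by
      funext x
      simp only [Function.update_apply]
      split_ifs <;> omega)
  have h0 : update (update (update s b (s b + 0)) c 0) a (s a - 0) = s := by
    funext x
    simp only [Function.update_apply]
    split_ifs with h₁ h₂ h₃ <;> simp_all
  rw [h0] at this
  refine (this.seq (runs_move hac.symm)).congr ?_
  funext x
  simp only [Function.update_apply]
  split_ifs with h₁ h₂ h₃ h₄ <;> simp_all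

/-- The function `f`, which depends on an oracle, is computed by programs: for all registers that
hold the arguments, there is a program that adds the value to a given register, if the query string
satisfies `P` and the registers from `base` on are empty. -/
def Impl (P : List Bool → Prop) {n : ℕ} (f : (ℕ → Bool) → List.Vector ℕ n → ℕ) : Prop :=
  ∀ (args : Fin n → ℕ) (out base : ℕ), (∀ i, args i < base) → (∀ i, args i ≠ out) → out < base →
    ∃ c, ∀ A s w, P w → (∀ r ≥ base, s r = 0) →
      Runs A c s w (update s out (s out + f A (.ofFn fun i => s (args i)))) w

variable {P : List Bool → Prop} {n : ℕ}

theorem impl_zero : Impl P fun _ (_ : List.Vector ℕ 0) => 0 := fun _ out _ _ _ _ =>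
  ⟨seq (inc out) (dec out), fun _ _ _ _ _ => (runs_inc.seq runs_dec).congr (by simp)⟩

theorem impl_get (i : Fin n) : Impl P fun _ v => v.get i := fun args out base h₁ h₂ h₃ =>
  ⟨copy (args i) out base, fun A s w _ hs => (runs_copy (h₂ i) (h₁ i).ne h₃.ne
    (hs _ le_rfl)).congr (by simp)⟩

theorem impl_succ : Impl P fun _ (v : List.Vector ℕ 1) => v.head.succ := fun args out base h₁ h₂ h₃ =>
  ⟨seq (copy (args 0) out base) (inc out), fun A s w _ hs => ((runs_copy (h₂ 0) (h₁ 0).ne h₃.ne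
    (hs _ le_rfl)).seq runs_inc).congr (by simp [Nat.add_assoc])⟩

theorem exists_runs_clear (base k : ℕ) : ∃ c, ∀ A s w,
    Runs A c s w (fun r => if base ≤ r ∧ r < base + k then 0 else s r) w := by
  induction k with
  | zero =>
    refine ⟨seq (inc 0) (dec 0), fun A s w => (runs_inc.seq runs_dec).congr ?_⟩
    funext x
    rw [if_neg (by omega)]
    simp
  | succ k ih =>
    obtain ⟨c, hc⟩ := ih
    refine ⟨seq c (loop (base + k) (dec (base + k))), fun A s w => ((hc A s w).seq
      runs_clear).congr ?_⟩
    funext x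
    simp only [Function.update_apply]
    split_ifs <;> first | rfl | omega

/-- The values of the `g i` are stored in the registers from `base` to `base + n - 1`, with scratch
space for every subprogram starting at `base + n`. After `f` has been applied to them these
registers are cleared, as the convention requires. -/
theorem Impl.comp {m : ℕ} {f : (ℕ → Bool) → List.Vector ℕ n → ℕ}
    {g : Fin n → (ℕ → Bool) → List.Vector ℕ m → ℕ} (hf : Impl P f) (hg : ∀ i, Impl P (g i)) :
    Impl P fun A v => f A (.ofFn fun i => g i A v) := by
  intro args out base h₁ h₂ h₃
  let val (A : ℕ → Bool) (s : ℕ → ℕ) (j : ℕ) : ℕ :=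
    if h : j < n then g ⟨j, h⟩ A (.ofFn fun i => s (args i)) else 0
  have key : ∀ k ≤ n, ∃ c, ∀ A s w, P w → (∀ r ≥ base, s r = 0) →
      Runs A c s w (fun r => if base ≤ r ∧ r < base + k then val A s (r - base) else s r) w := by
    intro k hk
    induction k with
    | zero =>
      refine ⟨seq (inc 0) (dec 0), fun A s w _ _ => (runs_inc.seq runs_dec).congr ?_⟩
      funext x
      rw [if_neg (by omega)]
      simp
    | succ k ih =>
      obtain ⟨c, hc⟩ := ih (by omega)
      obtain ⟨d, hd⟩ := hg ⟨k, by omega⟩ args (base + k) (base + n)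
        (fun i => by have := h₁ i; omega) (fun i => by have := h₁ i; omega) (by omega)
      refine ⟨seq c d, fun A s w hw hs => ((hc A s w hw hs).seq (hd A _ w hw ?_)).congr ?_⟩
      · intro r hr
        rw [if_neg (by omega)]
        exact hs _ (by omega)
      · funext x
        have harg : ∀ i, (if base ≤ args i ∧ args i < base + k then val A s (args i - base)
            else s (args i)) = s (args i) := fun i => if_neg (by have := h₁ i; omega)
        simp only [harg, Function.update_apply]
        by_cases hx : x = base + k
        · subst hx
          rw [if_pos rfl, if_neg (by omega), if_pos (by omega), hs _ (by omega)]
          simp only [val, Nat.add_sub_cancel_left]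
          rw [dif_pos (by omega), zero_add]
        · rw [if_neg hx]
          split_ifs <;> first | rfl | omega
  obtain ⟨c₁, hc₁⟩ := key n le_rfl
  obtain ⟨c₂, hc₂⟩ := hf (fun i => base + i) out (base + n) (fun i => by omega)
    (fun i => by omega) (by omega)
  obtain ⟨c₃, hc₃⟩ := exists_runs_clear base n
  refine ⟨seq c₁ (seq c₂ c₃), fun A s w hw hs => ((hc₁ A s w hw hs).seq ((hc₂ A _ w hw ?_).seq
    (hc₃ A _ w))).congr ?_⟩
  · intro r hr
    rw [if_neg (by omega)]
    exact hs _ (by omega)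
  · funext x
    have harg : ∀ i : Fin n, (if base ≤ base + i.1 ∧ base + i.1 < base + n
        then val A s (base + i.1 - base) else s (base + i)) =
        g i A (.ofFn fun i => s (args i)) := fun i => by
      rw [if_pos (by omega), Nat.add_sub_cancel_left]
      exact dif_pos i.2
    simp only [harg, Function.update_apply]
    by_cases hx : base ≤ x ∧ x < base + n
    · rw [if_pos hx, if_neg (by omega), hs _ hx.1]
    · simp only [if_neg hx]
      rw [if_neg (by omega : ¬ (base ≤ out ∧ out < base + n))]

theorem ofFn_cons {m : ℕ} (k : ℕ) (args : Fin m → ℕ) (s : ℕ → ℕ) :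
    List.Vector.ofFn (fun i => s ((Fin.cons k args : Fin (m + 1) → ℕ) i)) =
      s k ::ᵥ List.Vector.ofFn fun i => s (args i) := rfl

theorem Impl.prec {f : (ℕ → Bool) → List.Vector ℕ n → ℕ}
    {g : (ℕ → Bool) → List.Vector ℕ (n + 2) → ℕ} (hf : Impl P f) (hg : Impl P g) :
    Impl P fun A (v : List.Vector ℕ (n + 1)) =>
      v.head.rec (f A v.tail) fun y IH => g A (y ::ᵥ IH ::ᵥ v.tail) := by
  intro args out base h₁ h₂ h₃
  have h₁' (i : Fin n) := h₁ i.succ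
  -- Layout: `base` holds the current value of the recursion, `base + 1` the index reached, `base +
  -- 2` the number of rounds left, and `base + 3` the next value while it is being computed.
  obtain ⟨c₁, hc₁⟩ := hf (fun i => args i.succ) base (base + 4)
    (fun i => by have := h₁' i; omega) (fun i => by have := h₁' i; omega) (by omega)
  obtain ⟨c₂, hc₂⟩ := hg (Fin.cons (base + 1) (Fin.cons base fun i => args i.succ)) (base + 3)
    (base + 4)
    (by refine Fin.cases (by simp) (Fin.cases (by simp) fun i => ?_)
        have := h₁' i; simp only [Fin.cons_succ]; omega)
    (by refine Fin.cases (by simp) (Fin.cases (by simp) fun i => ?_)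
        have := h₁' i; simp only [Fin.cons_succ]; omega) (by omega)
  refine ⟨seq (seq c₁ (copy (args 0) (base + 2) (base + 3))) (seq
    (loop (base + 2) (seq (dec (base + 2)) (seq c₂ (seq (loop base (dec base))
      (seq (move (base + 3) base) (inc (base + 1)))))))
    (seq (move base out) (loop (base + 1) (dec (base + 1))))), fun A s w hw hs => ?_⟩
  have h0 := h₁ 0
  set v := List.Vector.ofFn fun i : Fin n => s (args i.succ) with hv
  let R (i : ℕ) : ℕ := i.rec (f A v) fun y IH => g A (y ::ᵥ IH ::ᵥ v)
  let S (i : ℕ) : ℕ → ℕ :=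
    update (update (update s base (R i)) (base + 1) i) (base + 2) (s (args 0) - i)
  have hS : ∀ i x, x < base ∨ base + 3 ≤ x → S i x = s x := fun i x hx => by
    simp only [S]
    rw [Function.update_of_ne (by omega), Function.update_of_ne (by omega),
      Function.update_of_ne (by omega)]
  have hstart : Runs A (seq c₁ (copy (args 0) (base + 2) (base + 3))) s w (S 0) w := by
    refine ((hc₁ A s w hw fun r hr => hs _ (by omega)).seq (runs_copy (by omega) (by omega)
      (by omega) ?_)).congr ?_
    · rw [Function.update_of_ne (by omega)]
      exact hs _ (by omega)
    · funext x
      have e₀ := hs base le_rfl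
      have e₁ := hs (base + 1) (by omega)
      have e₂ := hs (base + 2) (by omega)
      have eR : R 0 = f A v := rfl
      simp only [S, ← hv, eR]
      clear_value R
      rcases (by omega : x = base ∨ x = base + 1 ∨ x = base + 2 ∨
        (x ≠ base ∧ x ≠ base + 1 ∧ x ≠ base + 2)) with rfl | rfl | rfl | h <;>
      · simp only [Function.update_apply]
        split_ifs <;> omega
  have hbody : ∀ i < s (args 0), Runs A (seq (dec (base + 2)) (seq c₂ (seq (loop base (dec base))
      (seq (move (base + 3) base) (inc (base + 1)))))) (S i) w (S (i + 1)) w := by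
    intro i hi
    refine (runs_dec.seq ((hc₂ A _ w hw ?_).seq (runs_clear.seq ((runs_move (by omega)).seq
      runs_inc)))).congr ?_
    · intro r hr
      rw [Function.update_of_ne (by omega), hS _ _ (by omega)]
      exact hs _ (by omega)
    · set S' := update (S i) (base + 2) (S i (base + 2) - 1) with hS'
      have e₁ : S' (base + 1) = i := by simp [S', S]
      have e₀ : S' base = R i := by simp [S', S]
      have ea : ∀ j : Fin n, S' (args j.succ) = s (args j.succ) := fun j => by
        have := h₁' j
        rw [hS', Function.update_of_ne (by omega), hS _ _ (by omega)]
      have e₃ : S' (base + 3) = 0 := by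
        rw [hS', Function.update_of_ne (by omega), hS _ _ (by omega)]
        exact hs _ (by omega)
      have e₂ : S' (base + 2) = s (args 0) - (i + 1) := by simp [S', S, Nat.sub_sub]
      have ex : ∀ x, x < base ∨ base + 3 ≤ x → S' x = s x := fun x hx => by
        rw [hS', Function.update_of_ne (by omega), hS _ _ hx]
      rw [ofFn_cons, ofFn_cons, e₁, e₀]
      simp only [ea, ← hv, e₃, zero_add]
      have hR : g A (i ::ᵥ R i ::ᵥ v) = R (i + 1) := rfl
      rw [hR]
      clear_value S' R
      funext x
      rcases (by omega : x < base ∨ x = base ∨ x = base + 1 ∨ x = base + 2 ∨ x = base + 3 ∨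
        base + 3 < x) with h | rfl | rfl | rfl | rfl | h
      · rw [hS _ _ (by omega), ← ex _ (by omega)]
        simp only [Function.update_apply]
        split_ifs <;> first | rfl | omega
      · simp [S]
      · simp [S, e₁]
      · simp [S, e₂]
      · rw [hS _ _ (by omega), hs _ (by omega)]
        simp
      · rw [hS _ _ (by omega), ← ex _ (by omega)]
        simp only [Function.update_apply]
        split_ifs <;> first | rfl | omega
  have hloop := runs_loop (r := base + 2) (S := S) (W := fun _ => w) (s (args 0))
    (fun i hi => by simp [S]; omega) (by simp [S]) hbody
  have hend : Runs A (seq (move base out) (loop (base + 1) (dec (base + 1)))) (S (s (args 0))) w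
      (update s out (s out + R (s (args 0)))) w := by
    refine ((runs_move (by omega)).seq runs_clear).congr ?_
    rw [hS _ out (by omega)]
    have e₀ : S (s (args 0)) base = R (s (args 0)) := by simp [S]
    rw [e₀]
    funext x
    rcases (by omega : x = out ∨ x = base ∨ x = base + 1 ∨ x = base + 2 ∨
      (x ≠ out ∧ (x < base ∨ base + 3 ≤ x))) with rfl | rfl | rfl | rfl | ⟨h, h'⟩
    · simp only [Function.update_apply]
      split_ifs <;> omega
    · have := hs x le_rfl
      simp only [Function.update_apply]
      split_ifs <;> omega
    · have := hs (base + 1) (by omega)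
      simp only [Function.update_apply]
      split_ifs <;> omega
    · have := hs (base + 2) (by omega)
      simp only [S, Function.update_apply]
      split_ifs <;> omega
    · have := hS (s (args 0)) x h'
      simp only [Function.update_apply]
      split_ifs <;> omega
  refine (hstart.seq (hloop.seq hend)).congr ?_
  simp [R, hv]

end Cmd

/-! ### Programs with unbounded search and oracle queries -/

namespace Cmd

open Function (update)

variable {P : List Bool → Prop} {n : ℕ}

theorem Impl.find {f : (ℕ → Bool) → List.Vector ℕ (n + 1) → ℕ} (hf : Impl P f)
    {g : (ℕ → Bool) → List.Vector ℕ n → ℕ} (hg : ∀ A v, f A (g A v ::ᵥ v) = 0)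
    (hg' : ∀ A v, ∀ k < g A v, f A (k ::ᵥ v) ≠ 0) : Impl P g := by
  intro args out base h₁ h₂ h₃
  obtain ⟨c, hc⟩ := hf (Fin.cons base args) (base + 1) (base + 2)
    (by refine Fin.cases (by simp) fun i => ?_
        have := h₁ i; simp only [Fin.cons_succ]; omega)
    (by refine Fin.cases (by simp) fun i => ?_
        have := h₁ i; simp only [Fin.cons_succ]; omega) (by omega)
  -- The candidate is in `base` and the value of `f` at it in `base + 1`. As long as this value is
  -- nonzero it is erased, the candidate is increased, and `f` is evaluated again.
  refine ⟨seq c (seq (loop (base + 1) (seq (loop (base + 1) (dec (base + 1)))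
    (seq (inc base) c))) (move base out)), fun A s w hw hs => ?_⟩
  set v := List.Vector.ofFn fun i : Fin n => s (args i) with hv
  let S (i : ℕ) : ℕ → ℕ := update (update s base i) (base + 1) (f A (i ::ᵥ v))
  have hcs : ∀ i, Runs A c (update s base i) w (S i) w := fun i => by
    refine (hc A _ w hw fun r hr => ?_).congr ?_
    · rw [Function.update_of_ne (by omega)]
      exact hs _ (by omega)
    · have ea : ∀ j : Fin n, update s base i (args j) = s (args j) := fun j => by
        have := h₁ j
        rw [Function.update_of_ne (by omega)]
      rw [ofFn_cons]
      simp only [ea, ← hv, S]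
      rw [Function.update_of_ne (by omega : base + 1 ≠ base), hs _ (by omega)]
      simp
  have hstart : Runs A c s w (S 0) w := by
    have := hcs 0
    rwa [Function.update_eq_self_iff.2 (hs base le_rfl).symm] at this
  have hbody : ∀ i < g A v, Runs A (seq (loop (base + 1) (dec (base + 1))) (seq (inc base) c))
      (S i) w (S (i + 1)) w := by
    intro i hi
    refine runs_clear.seq (runs_inc.seq ?_)
    convert hcs (i + 1) using 1
    funext x
    have := hs (base + 1) (by omega)
    rcases (by omega : x = base ∨ x = base + 1 ∨ (x ≠ base ∧ x ≠ base + 1)) with rfl | rfl | h <;>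
    · simp only [S, Function.update_apply]
      split_ifs <;> omega
  have hloop := runs_loop (r := base + 1) (S := S) (W := fun _ => w) (g A v)
    (fun i hi => by simpa [S] using hg' A v i hi) (by simp [S, hg]) hbody
  refine (hstart.seq (hloop.seq (runs_move (by omega)))).congr ?_
  funext x
  have := hs base le_rfl
  have := hs (base + 1) (by omega)
  rw [show S (g A v) = update (update s base (g A v)) (base + 1) 0 by simp [S, hg]]
  rcases (by omega : x = base ∨ x = base + 1 ∨ x = out ∨
    (x ≠ base ∧ x ≠ base + 1 ∧ x ≠ out)) with rfl | rfl | rfl | h <;>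
  · simp only [Function.update_apply]
    split_ifs <;> omega

theorem _root_.Nat.Primrec'.impl {f : List.Vector ℕ n → ℕ} (hf : Nat.Primrec' f) :
    Impl P fun _ => f := by
  induction hf with
  | zero => exact impl_zero
  | succ => exact impl_succ
  | get i => exact impl_get i
  | comp g _ _ ihf ihg => exact Impl.comp ihf ihg
  | prec _ _ ihf ihg => exact Impl.prec ihf ihg

theorem Impl.comp₂ {f : ℕ → ℕ → ℕ} (hf : Primrec₂ f) {g h : (ℕ → Bool) → List.Vector ℕ n → ℕ}
    (hg : Impl P g) (hh : Impl P h) : Impl P fun A v => f (g A v) (h A v) := by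
  have := Impl.comp (n := 2) (g := ![g, h]) (Nat.Primrec'.impl (Nat.Primrec'.prim_iff₂.2 hf))
    (Fin.forall_fin_two.2 ⟨hg, hh⟩)
  exact this

theorem impl_head : Impl P fun _ (v : List.Vector ℕ (n + 1)) => v.head := by
  have := impl_get (P := P) (0 : Fin (n + 1))
  simpa only [List.Vector.get_zero] using this

/-- Kleene normal form: search for a step bound that makes `evaln` succeed, then read off its value.
Both the test and the extraction are primitive recursive, so a single unbounded search suffices. -/
theorem _root_.Computable.impl {f : ℕ → ℕ} (hf : Computable f) {g : (ℕ → Bool) → List.Vector ℕ n → ℕ}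
    (hg : Impl P g) : Impl P fun A v => f (g A v) := by
  obtain ⟨c, hc⟩ := Nat.Partrec.Code.exists_code.1 (Partrec.nat_iff.1 hf)
  have hex : ∀ m, ∃ k, (c.evaln k m).isSome := fun m => by
    have : f m ∈ c.eval m := by rw [hc]; exact Part.mem_some _
    obtain ⟨k, hk⟩ := Nat.Partrec.Code.evaln_complete.1 this
    exact ⟨k, by rw [Option.mem_def.1 hk]; rfl⟩
  have hev : Primrec₂ fun k m => c.evaln k m :=
    Nat.Partrec.Code.primrec_evaln.comp ((Primrec.fst.pair (.const c)).pair Primrec.snd)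
  have hT : Primrec₂ fun k m => bif (c.evaln k m).isSome then 0 else 1 :=
    Primrec.cond (Primrec.option_isSome.comp hev) (.const 0) (.const 1)
  have hU : Primrec₂ fun k m => (c.evaln k m).getD 0 :=
    Primrec.option_getD.comp hev (.const 0)
  have hfind : Impl P fun (_ : ℕ → Bool) (v : List.Vector ℕ 1) => Nat.find (hex v.head) := by
    refine Impl.find (f := fun _ v => bif (c.evaln v.head v.tail.head).isSome then 0 else 1)
      (Nat.Primrec'.prim_iff₂.2 hT).impl (fun _ v => ?_) (fun _ v k hk => ?_)
    · simp [Nat.find_spec (hex v.head)]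
    · have := Nat.find_min (hex v.head) hk
      simp only [Bool.not_eq_true] at this
      simp [this]
  have h1 : Impl P fun (_ : ℕ → Bool) (v : List.Vector ℕ 1) => f v.head := by
    have := Impl.comp₂ hU hfind impl_head
    convert this using 3 with _ v
    obtain ⟨y, hy⟩ := Option.isSome_iff_exists.1 (Nat.find_spec (hex v.head))
    have := Nat.Partrec.Code.evaln_sound (Option.mem_def.2 hy)
    rw [hc] at this
    rw [hy]
    exact (Part.mem_some_iff.1 this).symm
  exact Impl.comp (g := fun _ => g) h1 fun _ => hg

/-- Whether the bit `b` is to be emitted as the `k`-th bit, counted from the end, of the string with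
number `m`. -/
def emits (b : Bool) (m k : ℕ) : ℕ :=
  if (m + 1) / 2 ^ (k + 1) ≠ 0 ∧ (m + 1) / 2 ^ k % 2 = b.toNat then 1 else 0

theorem primrec_nat_pow : Primrec₂ ((· ^ ·) : ℕ → ℕ → ℕ) := by
  rw [← Primrec₂.unpaired']
  exact Nat.Primrec.pow

theorem primrec_emits (b : Bool) : Primrec₂ (emits b) := by
  have h (f : ℕ × ℕ → ℕ) (hf : Primrec f) : Primrec fun p : ℕ × ℕ => (p.1 + 1) / 2 ^ f p :=
    Primrec.nat_div.comp (Primrec.succ.comp .fst) (primrec_nat_pow.comp (.const 2) hf)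
  refine Primrec.ite (PrimrecPred.and (PrimrecPred.not ?_) ?_) (.const 1) (.const 0)
  · exact Primrec.eq.comp (h _ (Primrec.succ.comp .snd)) (.const 0)
  · exact Primrec.eq.comp (Primrec.nat_mod.comp (h _ .snd) (.const 2)) (.const _)

theorem strNum_append (w : List Bool) (b : Bool) : strNum (w ++ [b]) = 2 * strNum w + 1 + b.toNat := by
  simp [strNum]

/-- The prefix of the string with number `m` that consists of all but the last `k` bits. -/
def prefixOf (m : ℕ) : ℕ → ℕ → List Bool
  | 0, _ => []
  | i + 1, k => prefixOf m i (k + 1) ++ (if emits false m k = 1 then [false] else []) ++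
      if emits true m k = 1 then [true] else []

/-- The binary expansion of m + 1 is a leading 1 followed by the string with number m. Dropping the
last k bits of the string therefore turns m + 1 into ⌊(m + 1) / 2^k⌋. The hypothesis says that the
generation started above the leading bit; until that bit is passed nothing is emitted, and truncated
subtraction gives 0. -/
theorem strNum_prefixOf (m i k : ℕ) (h : (m + 1) / 2 ^ (k + i) = 0) :
    strNum (prefixOf m i k) = (m + 1) / 2 ^ k - 1 := by
  induction i generalizing k with
  | zero =>
    change (m + 1) / 2 ^ k = 0 at h
    rw [h]
    rfl
  | succ i ih =>
    have ih := ih (k + 1) (by rwa [Nat.add_right_comm])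
    rw [prefixOf]
    have e : (m + 1) / 2 ^ (k + 1) = (m + 1) / 2 ^ k / 2 := by
      rw [pow_succ, Nat.div_div_eq_div_mul]
    by_cases hz : (m + 1) / 2 ^ (k + 1) = 0
    · rw [hz] at ih
      simp only [emits, hz]
      simp only [ne_eq, not_true_eq_false, false_and, if_false, zero_ne_one, List.append_nil]
      omega
    · rcases Nat.mod_two_eq_zero_or_one ((m + 1) / 2 ^ k) with h2 | h2
      · rw [show emits false m k = 1 by rw [emits, if_pos ⟨hz, h2⟩],
          show emits true m k = 0 by rw [emits, if_neg (by simp [h2])], if_pos rfl,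
          if_neg (by simp), List.append_nil, strNum_append, ih, Bool.toNat_false, e]
        rw [e] at hz
        generalize (m + 1) / 2 ^ k = q at *
        omega
      · rw [show emits true m k = 1 by rw [emits, if_pos ⟨hz, h2⟩],
          show emits false m k = 0 by rw [emits, if_neg (by simp [h2])], if_pos rfl,
          if_neg (by simp), List.append_nil, strNum_append, ih, Bool.toNat_true, e]
        rw [e] at hz
        generalize (m + 1) / 2 ^ k = q at *
        omega

theorem runs_emit_if {A : ℕ → Bool} {r : ℕ} {s : ℕ → ℕ} {w : List Bool} {b : Bool}
    (h : s r ≤ 1) : Runs A (loop r (seq (dec r) (emit b))) s w (update s r 0)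
      (w ++ if s r = 1 then [b] else []) := by
  have := runs_loop (A := A) (r := r) (a := seq (dec r) (emit b))
    (S := fun i => update s r (s r - i)) (W := fun i => w ++ List.replicate i b) (s r)
    (fun i hi => by simp; omega) (by simp) (fun i hi => by
      have := (runs_dec (A := A) (r := r) (s := update s r (s r - i))
        (w := w ++ List.replicate i b)).seq (runs_emit (d := b))
      simpa [Nat.sub_sub, List.replicate_succ', ← List.append_assoc] using this)
  rcases (by omega : s r = 0 ∨ s r = 1) with h0 | h0 <;> rw [Nat.sub_zero, Function.update_eq_self] at this <;>
    simpa [h0] using this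

theorem impl_oracle : Impl (· = []) fun A (v : List.Vector ℕ 1) => (A v.head).toNat := by
  intro args out base h₁ h₂ h₃
  have h₁' := h₁ 0
  have h₂' := h₂ 0
  -- No condition on the query string may be imposed here, since these programs run while it is
  -- partially written.
  have hc (b : Bool) := (Nat.Primrec'.impl (P := fun _ => True)
    (Nat.Primrec'.prim_iff₂.2 (primrec_emits b)))
    ![args 0, base] (base + 1) (base + 2) (by simp [Fin.forall_fin_two]; omega)
    (by simp [Fin.forall_fin_two]; omega) (by omega)
  obtain ⟨c₀, hc₀⟩ := hc false
  obtain ⟨c₁, hc₁⟩ := hc true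
  let em (b : Bool) (c : Cmd) : Cmd := seq c (loop (base + 1) (seq (dec (base + 1)) (emit b)))
  refine ⟨seq (seq (copy (args 0) base (base + 1)) (inc base)) (seq
    (loop base (seq (dec base) (seq (em false c₀) (em true c₁)))) (ask out)),
    fun A s w hw hs => ?_⟩
  subst hw
  set m := s (args 0) with hm
  have hem (b : Bool) (c : Cmd) (hc : ∀ A s w, True → (∀ r ≥ base + 2, s r = 0) →
      Runs A c s w (update s (base + 1) (s (base + 1) +
        emits b (List.Vector.ofFn fun i => s (![args 0, base] i)).head
        (List.Vector.ofFn fun i => s (![args 0, base] i)).tail.head)) w) (k : ℕ) (w : List Bool) :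
      Runs A (em b c) (update s base k) w (update s base k)
        (w ++ if emits b m k = 1 then [b] else []) := by
    have h := hc A (update s base k) w trivial fun r hr => by
      rw [Function.update_of_ne (by omega)]
      exact hs _ (by omega)
    have e : update s base k (base + 1) = 0 := by
      rw [Function.update_of_ne (by omega)]
      exact hs _ (by omega)
    have e' : update s base k (args 0) = m := by
      rw [Function.update_of_ne (by omega)]
    have hval : (update s base k (base + 1) +
        emits b (List.Vector.ofFn fun i => update s base k (![args 0, base] i)).head
        (List.Vector.ofFn fun i => update s base k (![args 0, base] i)).tail.head) = emits b m k := by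
      rw [e]
      simp [List.Vector.ofFn, e']
    rw [hval] at h
    have h' := h.seq (runs_emit_if (b := b) (r := base + 1) (by
      simp only [Function.update_self, emits]; split_ifs <;> simp))
    simp only [Function.update_self, Function.update_idem] at h'
    refine h'.congr ?_
    rw [Function.update_eq_self_iff.2 e.symm]
  have hstart : Runs A (seq (copy (args 0) base (base + 1)) (inc base)) s [] (update s base (m + 1)) [] := by
    refine ((runs_copy (by omega) (by omega) (by omega) (hs _ (by omega))).seq runs_inc).congr ?_
    simp [hs base le_rfl, hm]
  -- Bit positions are treated from m down to 0, most significant first. Starting this high is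
  -- enough because m + 1 < 2^(m + 1).
  have hloop := runs_loop (A := A) (r := base)
    (a := seq (dec base) (seq (em false c₀) (em true c₁)))
    (S := fun i => update s base (m + 1 - i)) (W := fun i => prefixOf m i (m + 1 - i)) (m + 1)
    (fun i hi => by simp; omega) (by simp) (fun i hi => by
      have h := (runs_dec (A := A) (r := base) (s := update s base (m + 1 - i))
        (w := prefixOf m i (m + 1 - i)))
      simp only [Function.update_self, Function.update_idem, Nat.sub_sub] at h
      have h' := h.seq ((hem false c₀ hc₀ _ _).seq (hem true c₁ hc₁ _ _))
      rw [prefixOf, (by omega : m + 1 - (i + 1) + 1 = m + 1 - i)]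
      exact h')
  refine (hstart.seq (hloop.seq runs_ask)).congr ?_
  have e : strNum (prefixOf m (m + 1) (m + 1 - (m + 1))) = m := by
    rw [strNum_prefixOf]
    · simp
    · rw [Nat.div_eq_of_lt]
      refine lt_of_lt_of_le Nat.lt_two_pow_self (Nat.pow_le_pow_right (by norm_num) (by omega))
  rw [e]
  have e0 := hs base le_rfl
  rw [Nat.sub_self, (Function.update_eq_self_iff.2 e0.symm : update s base 0 = s)]
  rfl

end Cmd

/-- The first `m` bits of an infinite binary sequence. -/
def initialSegment (A : ℕ → Bool) (m : ℕ) : List Bool := (List.range m).map A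

theorem initialSegment_succ (A : ℕ → Bool) (m : ℕ) :
    initialSegment A (m + 1) = initialSegment A m ++ [A m] := by
  simp [initialSegment, List.range_succ]

/-! ### Fast oracle tests with a slow fallback -/

namespace Cmd

open Function (update)

/-- Append a bit to the list of bits with a given code. -/
def appendCode (l b : ℕ) : ℕ :=
  Encodable.encode (((Encodable.decode l : Option (List Bool)).getD []) ++ [decide (b = 1)])

theorem primrec_appendCode : Primrec₂ appendCode := by
  refine Primrec.encode.comp (Primrec.list_concat.comp ?_ ?_)
  · exact Primrec.option_getD.comp (Primrec.decode.comp .fst) (.const [])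
  · exact (Primrec.eq (α := ℕ)).decide.comp .snd (.const 1)

/-- Primitive recursion on the length, with one oracle query per round. A query erases the query
tape, so the requirement that it be empty holds again afterwards. -/
theorem impl_initialSegment : Impl (· = []) fun A (v : List.Vector ℕ 1) =>
    Encodable.encode (initialSegment A v.head) := by
  have h := Impl.prec (n := 0) impl_zero (Impl.comp₂ (n := 2) primrec_appendCode (impl_get 1)
    (Impl.comp (n := 1) (g := fun _ _ v => v.get 0) impl_oracle fun _ => impl_get 0))
  convert h using 3 with A v
  generalize v.head = m
  induction m with
  | zero => rfl
  | succ m ih =>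
    rw [initialSegment_succ]
    refine Eq.trans ?_ (congrArg (fun x => appendCode x (A m).toNat) ih)
    simp only [appendCode, Encodable.encodek, Option.getD_some]
    cases A m <;> rfl

theorem impl_test {R : ℕ → List Bool → Bool} (hR : Computable₂ R) : Impl (· = [])
    fun A (v : List.Vector ℕ 1) => (R v.head (initialSegment A v.head)).toNat := by
  have hc : Computable fun p : ℕ => (R p.unpair.1
      ((Encodable.decode p.unpair.2 : Option (List Bool)).getD [])).toNat := by
    refine (Primrec.dom_bool Bool.toNat).to_comp.comp (hR.comp (Computable.fst.comp .unpair) ?_)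
    exact (Primrec.option_getD.comp (Primrec.decode.comp (Primrec.snd.comp .unpair))
      (.const [])).to_comp
  have := hc.impl (Impl.comp₂ Primrec₂.natPair impl_head impl_initialSegment)
  simpa using this

theorem runs_of_impl {f : (ℕ → Bool) → List.Vector ℕ 1 → ℕ} (hf : Impl (· = []) f) {out base : ℕ}
    (h0 : 0 < out) (hb : out < base) : ∃ c, ∀ (A : ℕ → Bool) (s : ℕ → ℕ) (m : ℕ), s 0 = m →
      (∀ r ≥ base, s r = 0) →
      Runs A c s [] (update s out (s out + f A (m ::ᵥ .nil))) [] := by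
  obtain ⟨c, hc⟩ := hf (fun _ => 0) out base (fun _ => by omega) (fun _ => by omega) hb
  refine ⟨c, fun A s m hm hs => ?_⟩
  subst hm
  exact hc A s [] rfl hs

/-- If every oracle machine that halts on all sequences of ones with all oracles has a computable
time bound that does not depend on the oracle, then a time bound for testing `R` can be given
before the language `ℓ` that is decided when the test fails. -/
theorem exists_fast_machine
    (bdd : ∀ M : OracleMachine, (∀ A m, ∃ T, M.run A T (M.initial (List.replicate m true)) ≠ none) →
      ∃ h : ℕ → ℕ, Computable h ∧ ∀ A m, M.run A (h m) (M.initial (List.replicate m true)) ≠ none)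
    {R : ℕ → List Bool → Bool} (hR : Computable₂ R) :
    ∃ h : ℕ → ℕ, Computable h ∧ ∀ ℓ : ℕ → Bool, Computable ℓ → ∀ A : ℕ → Bool,
      (∀ m, R m (initialSegment A m) = true → ℓ m = false) →
      ∃ (M : OracleMachine) (f : ℕ → ℕ),
        M.DecidesInTime A {x | (∀ b ∈ x, b = true) ∧ ℓ x.length = true} (fun x => f x.length) ∧
        ∀ m, R m (initialSegment A m) = true → f m ≤ h m := by
  obtain ⟨c, hc⟩ := runs_of_impl (impl_test hR) (out := 2) (base := 4) (by omega) (by omega)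
  have hin (m : ℕ) : ∀ r ≥ 1, inputReg m r = 0 := fun r hr => by
    rw [inputReg, Function.update_of_ne (by omega)]
  have hc' (A : ℕ → Bool) (m : ℕ) : Runs A c (inputReg m) []
      (update (inputReg m) 2 (R m (initialSegment A m)).toNat) [] := by
    have := hc A (inputReg m) m (by simp [inputReg]) fun r hr => hin m r (by omega)
    rw [hin m 2 (by omega), zero_add] at this
    exact this
  -- `N` executes only the test. A uniform time bound for it limits the time of the same code inside
  -- the final machine, and `ℓ` has not yet been introduced.
  obtain ⟨N, hN⟩ := exists_machine c
  obtain ⟨h, hh, hb⟩ := bdd N fun A m => by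
    obtain ⟨t, ht⟩ := hc' A m
    exact ⟨_, by rw [((hN A).2 m t _ ht).2]; simp⟩
  have hb' : ∀ A m t s, Exec A c (inputReg m) [] s [] t → m + t + 3 ≤ h m := by
    intro A m t s ht
    by_contra hlt
    rcases h1 : N.run A (h m) (N.initial (List.replicate m true)) with _ | b
    · exact hb A m h1
    · have := OracleMachine.run_mono (by omega : h m ≤ m + t + 2) h1
      rw [((hN A).2 m t _ ht).1] at this
      cases this
  -- When the test succeeds, the commands around it cost exactly 10 extra steps.
  refine ⟨fun m => h m + 10, (Primrec.nat_add.comp .id (.const 10)).to_comp.comp hh,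
    fun ℓ hℓ A hA => ?_⟩
  obtain ⟨d, hd⟩ := runs_of_impl (((Primrec.dom_bool Bool.toNat).to_comp.comp hℓ).impl
    (n := 1) impl_head) (out := 1) (base := 4) (by omega) (by omega)
  -- A conditional: register `2` holds the result of the test, and register `3` is a flag that is
  -- lowered if the test succeeded. The program `d` for `ℓ` runs only if the flag is still up.
  -- Otherwise register `1` stays 0, which means rejection.
  obtain ⟨M, hM⟩ := exists_machine (seq c (seq (inc 3) (seq (loop 2 (seq (dec 2) (dec 3)))
    (loop 3 (seq (dec 3) d)))))
  have hfast : ∀ m, R m (initialSegment A m) = true →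
      M.run A (h m + 10) (M.initial (List.replicate m true)) = some false := by
    intro m hm
    obtain ⟨t, ht⟩ := hc' A m
    have hle := hb' A m t _ ht
    rw [hm] at ht
    have := (hM A).2 m _ _ (ht.seq (exec_inc.seq ((Exec.loop (by simp) (exec_dec.seq exec_dec)
      (exec_loop_zero (by simp))).seq (exec_loop_zero (by simp [hin])))))
    have := OracleMachine.run_mono (t := h m + 10) (by omega) this.2
    rw [this]
    simp [hin]
  have hslow : ∀ m, R m (initialSegment A m) = false →
      ∃ T, M.run A T (M.initial (List.replicate m true)) = some (ℓ m) := by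
    intro m hm
    have hcm := hc' A m
    rw [hm] at hcm
    have e : update (inputReg m) 2 false.toNat = inputReg m := by simp [hin]
    rw [e] at hcm
    have e1 : update (update (inputReg m) 3 (inputReg m 3 + 1)) 3
        (update (inputReg m) 3 (inputReg m 3 + 1) 3 - 1) = inputReg m := by simp
    have hdm := hd A (inputReg m) m (by simp [inputReg]) fun r hr => hin m r (by omega)
    obtain ⟨_, h₁⟩ := hcm
    obtain ⟨_, h₂⟩ := hdm
    have h₃ := exec_dec (A := A) (r := 3) (s := update (inputReg m) 3 (inputReg m 3 + 1)) (w := [])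
    rw [e1] at h₃
    have := (hM A).2 m _ _ (h₁.seq (exec_inc.seq ((exec_loop_zero (by simp [hin])).seq
      (Exec.loop (by simp) (h₃.seq h₂) (exec_loop_zero (by simp [hin]))))))
    refine ⟨_, this.2.trans ?_⟩
    simp only [Function.update_self, hin m 1 le_rfl]
    cases h : ℓ m <;> simp [h]
  choose T hT using fun m => (by
    rcases hm : R m (initialSegment A m) with _ | _
    · exact hslow m hm
    · exact ⟨_, (hfast m hm).trans (by rw [hA m hm])⟩ :
    ∃ T, M.run A T (M.initial (List.replicate m true)) = some (ℓ m))
  -- This bound depends on the length only, so it is admissible under both time conventions. The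
  -- term `n + 1` pays for rejecting inputs that contain a zero.
  refine ⟨M, fun n => if R n (initialSegment A n) = true then h n + 10 else max (n + 1) (T n),
    fun x => ?_, fun m hm => by simp [hm]⟩
  dsimp only
  by_cases hx : ∀ b ∈ x, b = true
  · refine ⟨ℓ x.length, ?_, fun h => ⟨hx, h⟩, And.right⟩
    have e : x = List.replicate x.length true := List.eq_replicate_iff.2 ⟨rfl, hx⟩
    have h1 := hT x.length
    rw [← e] at h1
    split_ifs with hm
    · have := hfast _ hm
      rw [← e] at this
      rw [this, hA _ hm]
    · exact OracleMachine.run_mono (le_max_right _ _) h1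
  · refine ⟨false, OracleMachine.run_mono ?_ ((hM A).1 x (by
      by_contra hf
      exact hx fun b hb => by cases b <;> simp_all)), fun h => absurd h (by simp), fun h => absurd h.1 hx⟩
    split_ifs
    · obtain ⟨t, ht⟩ := hc' A x.length
      have := hb' A _ t _ ht
      omega
    · exact le_max_left _ _

end Cmd

/-! ### Runs of oracle machines are primitive recursive -/

theorem primrec_strNum : Primrec strNum :=
  Primrec.list_foldl (h := fun _ (p : ℕ × Bool) => 2 * p.1 + 1 + p.2.toNat) .id (.const 0) <| by
    refine Primrec.nat_add.comp (Primrec.nat_double_succ.comp ?_) ?_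
    · exact Primrec.fst.comp .snd
    · exact (Primrec.dom_bool Bool.toNat).comp (Primrec.snd.comp .snd)

theorem primrec_testBit : Primrec₂ Nat.testBit := by
  have h : Primrec₂ fun a n : ℕ => decide (a / 2 ^ n % 2 = 1) :=
    (Primrec.eq (α := ℕ)).decide.comp (Primrec.nat_mod.comp (Primrec.nat_div.comp .fst
      (Cmd.primrec_nat_pow.comp (.const 2) .snd)) (.const 2)) (.const 1)
  exact h.of_eq fun a n => (Nat.testBit_eq_decide_div_mod_eq).symm

namespace OracleMachine

section Representation

variable {Q Γ : Type} {n : ℕ} [Inhabited Γ] [Primcodable Q] [Primcodable Γ]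

/-- A copy of the type of actions in terms of products and sums. -/
abbrev ActionCode (Q Γ : Type) (n : ℕ) : Type :=
  Bool ⊕ ((Q × (Fin n → Γ) × (Fin n → Option Bool) × Option Bool) ⊕ (Q × Q))

/-- The element of `ActionCode` that corresponds to an action. -/
def actionCode : OracleAction Q Γ (Fin n) → ActionCode Q Γ n
  | .halt b => .inl b
  | .go q write move emit => .inr (.inl (q, write,
      fun i => (move i).map fun | .left => false | .right => true, emit))
  | .query q => .inr (.inr (q false, q true))

/-- A representation of configurations by lists; the second list of a tape begins with the symbol
under the head. -/
abbrev CfgCode (Q Γ : Type) (n : ℕ) : Type :=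
  Q × (Fin n → List Γ × List Γ) × List Bool

/-- Write a symbol on a tape and move the head. -/
def tapeStep (p : (Option Bool × Γ) × List Γ × List Γ) : List Γ × List Γ :=
  p.1.1.elim (p.2.1, p.1.2 :: p.2.2.tail) fun d =>
    bif d then (p.1.2 :: p.2.1, p.2.2.tail) else (p.2.1.tail, p.2.1.headI :: p.1.2 :: p.2.2.tail)

theorem primrec_tapeStep : Primrec (tapeStep (Γ := Γ)) := by
  have hL : Primrec fun p : (Option Bool × Γ) × List Γ × List Γ => p.2.1 :=
    Primrec.fst.comp .snd
  have hR : Primrec fun p : (Option Bool × Γ) × List Γ × List Γ => p.2.2.tail :=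
    Primrec.list_tail.comp (Primrec.snd.comp .snd)
  have hg : Primrec fun p : (Option Bool × Γ) × List Γ × List Γ => p.1.2 :=
    Primrec.snd.comp .fst
  have hgR := Primrec.list_cons.comp hg hR
  refine (Primrec.option_casesOn (Primrec.fst.comp .fst) (hL.pair hgR)
    (g := fun p d => bif d then (p.1.2 :: p.2.1, p.2.2.tail)
      else (p.2.1.tail, p.2.1.headI :: p.1.2 :: p.2.2.tail))
    (Primrec.cond .snd (((Primrec.list_cons.comp hg hL).pair hR).comp .fst)
      (((Primrec.list_tail.comp hL).pair (Primrec.list_cons.comp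
        (Primrec.list_headI.comp hL) hgR)).comp .fst))).of_eq fun p => ?_
  rw [tapeStep]
  cases p.1.1 <;> rfl

/-- One step of a machine with transition table `D`, with the oracle coded by the bits of a
number. -/
def codeStep (D : Q × (Fin n → Γ) → ActionCode Q Γ n) (p : ℕ × CfgCode Q Γ n) :
    CfgCode Q Γ n ⊕ Bool :=
  Sum.elim Sum.inr (Sum.elim
    (fun x => Sum.inl (x.1, fun i => tapeStep ((x.2.2.1 i, x.2.1 i), p.2.2.1 i),
      p.2.2.2 ++ x.2.2.2.toList))
    (fun x => Sum.inl (bif p.1.testBit (strNum p.2.2.2) then x.2 else x.1, p.2.2.1, [])))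
    (D (p.2.1, fun i => (p.2.2.1 i).2.headI))

/-- The transition table is a function on a finite type and hence primitive recursive; the rest is
list manipulation and one bit test. -/
theorem primrec_codeStep [Finite Q] [Finite Γ] (D : Q × (Fin n → Γ) → ActionCode Q Γ n) : Primrec (codeStep D) := by
  have happ {α σ : Type} [Primcodable α] [Primcodable σ] {f : α → Fin n → σ} {g : α → Fin n}
      (hf : Primrec f) (hg : Primrec g) : Primrec fun a => f a (g a) := Primrec.fin_app.comp hf hg
  have hT : Primrec fun p : ℕ × CfgCode Q Γ n => p.2.2.1 :=
    Primrec.fst.comp (Primrec.snd.comp .snd)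
  have hw : Primrec fun p : ℕ × CfgCode Q Γ n => p.2.2.2 :=
    Primrec.snd.comp (Primrec.snd.comp .snd)
  have hD : Primrec fun p : ℕ × CfgCode Q Γ n => D (p.2.1, fun i => (p.2.2.1 i).2.headI) := by
    refine (Primrec.dom_finite D).comp ((Primrec.fst.comp .snd).pair (Primrec.fin_curry.2 ?_))
    exact Primrec.list_headI.comp (Primrec.snd.comp (happ (hT.comp .fst) .snd))
  refine (Primrec.sumCasesOn hD (g := fun _ b => Sum.inr b)
    (h := fun p y => Sum.elim
      (fun x => Sum.inl (x.1, fun i => tapeStep ((x.2.2.1 i, x.2.1 i), p.2.2.1 i),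
        p.2.2.2 ++ x.2.2.2.toList))
      (fun x => Sum.inl (bif p.1.testBit (strNum p.2.2.2) then x.2 else x.1, p.2.2.1, [])) y)
    (Primrec.sumInr.comp .snd) ?_).of_eq fun p => ?_
  · refine (Primrec.sumCasesOn (f := Prod.snd) .snd
      (g := fun (p : (ℕ × CfgCode Q Γ n) × _) x =>
        Sum.inl (x.1, fun i => tapeStep ((x.2.2.1 i, x.2.1 i), p.1.2.2.1 i),
        p.1.2.2.2 ++ x.2.2.2.toList))
      (h := fun p x =>
        Sum.inl (bif p.1.1.testBit (strNum p.1.2.2.2) then x.2 else x.1, p.1.2.2.1, []))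
      ?_ ?_).of_eq fun p => ?_
    · refine Primrec.sumInl.comp ((Primrec.fst.comp .snd).pair (.pair (Primrec.fin_curry.2 ?_) ?_))
      · refine primrec_tapeStep.comp (.pair (.pair ?_ ?_) ?_)
        · exact happ (Primrec.fst.comp (Primrec.snd.comp (Primrec.snd.comp
            (Primrec.snd.comp .fst)))) .snd
        · exact happ (Primrec.fst.comp (Primrec.snd.comp
            (Primrec.snd.comp .fst))) .snd
        · exact happ (hT.comp (Primrec.fst.comp (Primrec.fst.comp .fst))) .snd
      · exact Primrec.list_append.comp (hw.comp (Primrec.fst.comp .fst))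
          (Primrec.optionToList.comp (Primrec.snd.comp (Primrec.snd.comp
            (Primrec.snd.comp .snd))))
    · refine Primrec.sumInl.comp (.pair (.cond ?_ (Primrec.snd.comp .snd)
        (Primrec.fst.comp .snd)) (.pair (hT.comp (Primrec.fst.comp .fst)) (.const [])))
      exact primrec_testBit.comp (Primrec.fst.comp (Primrec.fst.comp .fst))
        (primrec_strNum.comp (hw.comp (Primrec.fst.comp .fst)))
    · rcases p with ⟨p, _ | _⟩ <;> rfl
  · rw [codeStep]
    cases D (p.2.1, fun i => (p.2.2.1 i).2.headI) <;> rfl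

/-- One step of a machine, with outputs repeated forever. -/
def codeStep' (D : Q × (Fin n → Γ) → ActionCode Q Γ n) (a : ℕ) (x : CfgCode Q Γ n ⊕ Bool) :
    CfgCode Q Γ n ⊕ Bool :=
  Sum.elim (fun y => codeStep D (a, y)) Sum.inr x

theorem primrec_codeStep' [Finite Q] [Finite Γ] (D : Q × (Fin n → Γ) → ActionCode Q Γ n) : Primrec₂ (codeStep' D) := by
  refine (Primrec.sumCasesOn (f := Prod.snd) .snd (g := fun (p : ℕ × _) y => codeStep D (p.1, y))
    (h := fun _ b => Sum.inr b) ?_ ?_).of_eq fun p => ?_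
  · exact (primrec_codeStep D).comp ((Primrec.fst.comp .fst).pair .snd)
  · exact Primrec.sumInr.comp .snd
  · rcases p with ⟨p, _ | _⟩ <;> rfl

end Representation

variable (M : OracleMachine)

/-- The configuration with a given representation. -/
def ofCode (x : CfgCode M.Q M.Γ (M.extraTapes + 1)) : M.Cfg :=
  ⟨x.1, fun i => .mk₂ (x.2.1 i).1 (x.2.1 i).2, x.2.2⟩

/-- The transition table of a machine. -/
def table (p : M.Q × (Fin (M.extraTapes + 1) → M.Γ)) : ActionCode M.Q M.Γ (M.extraTapes + 1) :=
  actionCode (M.δ p.1 p.2)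

theorem ofCode_step (a : ℕ) (x : CfgCode M.Q M.Γ (M.extraTapes + 1)) :
    M.step a.testBit (M.ofCode x) = (codeStep M.table (a, x)).map M.ofCode id := by
  have hs : (fun i => ((M.ofCode x).tapes i).head) = fun i => (x.2.1 i).2.headI := rfl
  rw [step, codeStep, table, hs]
  change (match M.δ x.1 _ with
    | .halt b => _
    | .go q write move emit => _
    | .query q => _) = _
  rcases M.δ x.1 (fun i => (x.2.1 i).2.headI) with b | ⟨q, wr, mv, e⟩ | q
  · rfl
  · simp only [actionCode, Sum.elim_inr, Sum.elim_inl, Sum.map_inl, ofCode]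
    congr 2
    funext i
    rcases mv i with _ | _ | _ <;> rfl
  · simp only [actionCode, Sum.elim_inr, Sum.map_inl, ofCode]
    cases a.testBit (strNum x.2.2) <;> rfl

theorem run_ofCode (a t : ℕ) (x : CfgCode M.Q M.Γ (M.extraTapes + 1)) :
    M.run a.testBit t (M.ofCode x) = ((codeStep' M.table a)^[t] (.inl x)).getRight? := by
  induction t generalizing x with
  | zero => rfl
  | succ t ih =>
    rw [run, ofCode_step, Function.iterate_succ_apply]
    change _ = ((codeStep' M.table a)^[t] (codeStep M.table (a, x))).getRight?
    rcases codeStep M.table (a, x) with y | b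
    · exact ih y
    · rw [Function.iterate_fixed rfl]
      rfl

/-- With the oracle coded by the bits of a number, the output after a number of steps on a sequence
of ones is a primitive recursive function. -/
theorem primrec_run : Primrec fun p : ℕ × ℕ × ℕ =>
    M.run p.1.testBit p.2.1 (M.initial (List.replicate p.2.2 true)) := by
  obtain ⟨_, ⟨eQ⟩⟩ := Finite.exists_equiv_fin M.Q
  obtain ⟨_, ⟨eΓ⟩⟩ := Finite.exists_equiv_fin M.Γ
  let _ : Primcodable M.Q := .ofEquiv _ eQ
  let _ : Primcodable M.Γ := .ofEquiv _ eΓ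
  let ini (m : ℕ) : CfgCode M.Q M.Γ (M.extraTapes + 1) :=
    (M.start, fun i => ([], bif i = 0 then (List.range m).map fun _ => M.bit true else []), [])
  have hini : Primrec ini := by
    refine (Primrec.const _).pair (Primrec.pair (Primrec.fin_curry.2 (Primrec.pair (.const _) ?_)) (.const _))
    refine Primrec.cond ((Primrec.eq (α := Fin _)).decide.comp .snd (.const 0)) ?_ (.const _)
    exact Primrec.list_map (Primrec.list_range.comp .fst) (.const _)
  have hinit (m : ℕ) : M.ofCode (ini m) = M.initial (List.replicate m true) := by
    have : ∀ m, (List.range m).map (fun _ => M.bit true) = (List.replicate m true).map M.bit := by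
      simp [List.map_const']
    simp only [ofCode, ini, initial, Turing.Tape.mk₁, this]
    congr 1
    funext i
    by_cases hi : i = 0 <;> simp [hi]
  have hget : Primrec fun x : CfgCode M.Q M.Γ (M.extraTapes + 1) ⊕ Bool => x.getRight? := by
    refine (Primrec.sumCasesOn (f := id) .id (g := fun _ _ => none) (h := fun _ b => some b)
      (.const none) (Primrec.option_some.comp .snd)).of_eq ?_
    rintro (_ | _) <;> rfl
  refine (hget.comp (Primrec.nat_iterate (f := fun p : ℕ × ℕ × ℕ => p.2.1)
    (g := fun p => .inl (ini p.2.2)) (h := fun p x => codeStep' M.table p.1 x)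
    (Primrec.fst.comp .snd) (Primrec.sumInl.comp (hini.comp (Primrec.snd.comp .snd)))
    ((primrec_codeStep' M.table).comp (Primrec.fst.comp .fst) .snd))).of_eq fun p => ?_
  rw [← run_ofCode, hinit]

end OracleMachine

/-! ### Time bounds that do not depend on the oracle -/

theorem PrimrecRel.forall_lt' {α : Type*} [Primcodable α] {R : ℕ → α → Prop} (h : PrimrecRel R) :
    PrimrecRel fun n a => ∀ x < n, R x a :=
  (h.forall_mem_list.comp (Primrec.list_range.comp .fst) .snd).of_eq fun p => by simp

theorem strNum_lt (w : List Bool) : strNum w + 2 ≤ 2 ^ (w.length + 1) := by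
  induction w using List.reverseRecOn with
  | nil => simp [strNum]
  | append_singleton w b ih =>
    rw [Cmd.strNum_append, List.length_append, List.length_singleton, pow_succ]
    have : b.toNat ≤ 1 := Bool.toNat_le b
    omega

namespace OracleMachine

variable {M : OracleMachine}

/-- In `T` steps, only finitely many values of the oracle are used. -/
theorem run_congr {A B : ℕ → Bool} (T : ℕ) (c : M.Cfg)
    (h : ∀ n < 2 ^ (T + c.queryTape.length), A n = B n) : M.run A T c = M.run B T c := by
  induction T generalizing c with
  | zero => rfl
  | succ T ih =>
    have hstep : M.step A c = M.step B c := by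
      have : A (strNum c.queryTape) = B (strNum c.queryTape) := by
        refine h _ (lt_of_lt_of_le ?_ (Nat.pow_le_pow_right (by norm_num)
          (by omega : c.queryTape.length + 1 ≤ _)))
        have := strNum_lt c.queryTape
        omega
      rw [step, step, this]
    rw [run, run, ← hstep]
    have hlen : ∀ c', M.step A c = .inl c' → c'.queryTape.length ≤ c.queryTape.length + 1 := by
      intro c' hc'
      rw [step] at hc'
      split at hc'
      · cases hc'
      · cases hc'
        rename_i emit _
        cases emit <;> simp
      · cases hc'
        simp
    rcases hs : M.step A c with c' | b
    · have := hlen c' hs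
      exact ih c' fun n hn => h n (hn.trans_le (Nat.pow_le_pow_right (by norm_num) (by omega)))
    · rfl

/-- By `run_congr` the outcome depends on finitely many values of the oracle, so a whole basic
neighbourhood shares it. -/
theorem isOpen_run_ne_none (T : ℕ) (c : M.Cfg) : IsOpen {A : ℕ → Bool | M.run A T c ≠ none} := by
  rw [isOpen_iff_mem_nhds]
  intro A hA
  have hU : (⋂ n ∈ Set.Iio (2 ^ (T + c.queryTape.length)), {B : ℕ → Bool | B n = A n}) ∈ nhds A := by
    refine (Set.finite_Iio _).isOpen_biInter (fun n _ => ?_) |>.mem_nhds (by simp)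
    exact (isOpen_discrete ({A n} : Set Bool)).preimage (continuous_apply (A := fun _ : ℕ => Bool) n)
  filter_upwards [hU] with B hB
  simp only [Set.mem_iInter, Set.mem_Iio, Set.mem_ofPred_eq] at hB
  exact (run_congr T c hB).trans_ne hA

/-- If a machine halts with all oracles, then there is a time bound for all oracles. -/
theorem exists_forall_run_ne_none {c : M.Cfg} (h : ∀ A, ∃ T, M.run A T c ≠ none) :
    ∃ T, ∀ A, M.run A T c ≠ none := by
  obtain ⟨T, hT⟩ := isCompact_univ.elim_directed_cover
    (fun T => {A : ℕ → Bool | M.run A T c ≠ none}) (fun T => isOpen_run_ne_none T c)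
    (fun A _ => Set.mem_iUnion.2 (h A)) (directed_of_isDirected_le fun s t hst A hA => by
      obtain ⟨b, hb⟩ := Option.ne_none_iff_exists'.1 hA
      exact (run_mono hst hb).trans_ne (by simp))
  exact ⟨T, fun A => hT (Set.mem_univ A)⟩

theorem exists_computable_bound (h : ∀ A m, ∃ T, M.run A T (M.initial (List.replicate m true)) ≠ none) :
    ∃ h : ℕ → ℕ, Computable h ∧ ∀ A m, M.run A (h m) (M.initial (List.replicate m true)) ≠ none := by
  classical
  -- From an empty query tape, T steps can use the oracle only at numbers below 2^T. The 2^(2^T)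
  -- numbers `a` thus represent all oracles, and the condition is decidable. Compactness provides
  -- some T, and the least one is a computable function of m.
  let P (m T : ℕ) : Prop := ∀ a < 2 ^ 2 ^ T,
    M.run a.testBit T (M.initial (List.replicate m true)) ≠ none
  have hP : ∀ m, ∃ T, P m T := fun m =>
    let ⟨T, hT⟩ := exists_forall_run_ne_none fun A => h A m
    ⟨T, fun a _ => hT _⟩
  have hprim : PrimrecPred fun p : ℕ × ℕ => P p.1 p.2 := by
    have h1 : PrimrecRel fun (a : ℕ) (p : ℕ × ℕ) =>
        M.run a.testBit p.2 (M.initial (List.replicate p.1 true)) ≠ none :=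
      PrimrecPred.not (Primrec.eq.comp (M.primrec_run.comp (Primrec.fst.pair
        ((Primrec.snd.comp .snd).pair (Primrec.fst.comp .snd)))) (.const none))
    exact h1.forall_lt'.comp (Cmd.primrec_nat_pow.comp (.const 2)
      (Cmd.primrec_nat_pow.comp (.const 2) .snd)) .id
  refine ⟨_, Computable.find hprim.computablePred hP, fun A m => ?_⟩
  have hspec := Nat.find_spec (hP m)
  set T := Nat.find (hP m)
  rw [run_congr (B := (Nat.ofBits fun i : Fin (2 ^ T) => A i).testBit) T]
  · exact hspec _ (Nat.ofBits_lt_two_pow _)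
  · intro n hn
    rw [Nat.testBit_ofBits_lt _ _ (by simpa [initial] using hn)]

end OracleMachine

/-! ### The use principle -/

/-- A functional on finite strings approximates a partial function, given longer and longer initial
segments of `A`. -/
structure Approximates (F : List Bool → ℕ → Option ℕ) (A : ℕ → Bool) (f : ℕ →. ℕ) : Prop where
  sound : ∀ s n, ∀ v ∈ F (initialSegment A s) n, v ∈ f n
  complete : ∀ n, ∀ v ∈ f n, ∃ s₀, ∀ s ≥ s₀, v ∈ F (initialSegment A s) n

/-- A partial function that is recursive in `A` is approximated by a primitive recursive
functional. -/
theorem exists_approximates {A : ℕ → Bool} {f : ℕ →. ℕ} (hf : Nat.RecursiveIn {charFn A} f) :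
    ∃ F : List Bool → ℕ → Option ℕ, Primrec₂ F ∧ Approximates F A f := by
  have tot : ∀ g : ℕ → ℕ, Primrec g → ∃ F : List Bool → ℕ → Option ℕ, Primrec₂ F ∧
      Approximates F A fun n => Part.some (g n) := fun g hg =>
    ⟨fun _ n => some (g n), (Primrec.option_some.comp (hg.comp .snd)),
      fun s n v hv => Part.mem_some_iff.2 (Option.some.inj hv).symm,
      fun n v hv => ⟨0, fun s _ => congrArg some (Part.mem_some_iff.1 hv).symm⟩⟩
  induction hf with
  | zero => exact tot _ (.const 0)
  | succ => exact tot _ .succ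
  | left => exact tot _ (Primrec.fst.comp .unpair)
  | right => exact tot _ (Primrec.snd.comp .unpair)
  | oracle g hg =>
    obtain rfl := hg
    refine ⟨fun σ n => σ[n]?.map Bool.toNat, Primrec.option_map (Primrec.list_getElem?.comp .fst .snd)
      ((Primrec.dom_bool Bool.toNat).comp .snd), fun s n v hv => ?_, fun n v hv => ⟨n + 1,
      fun s hs => ?_⟩⟩
    · simp only [initialSegment, List.getElem?_map, Option.mem_def, Option.map_eq_some_iff] at hv
      obtain ⟨b, ⟨k, hk, rfl⟩, rfl⟩ := hv
      obtain ⟨h1, h2⟩ := List.getElem?_eq_some_iff.1 hk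
      rw [List.getElem_range] at h2
      subst h2
      exact Part.mem_some _
    · obtain rfl := Part.mem_some_iff.1 hv
      have : n < s := hs
      simp [initialSegment, List.getElem?_range this]
  | @pair f h _ _ ihf ihh =>
    obtain ⟨F, hF, hFA⟩ := ihf
    obtain ⟨H, hH, hHA⟩ := ihh
    refine ⟨fun σ n => (F σ n).bind fun a => (H σ n).map fun b => Nat.pair a b,
      Primrec.option_bind hF (Primrec.option_map (Primrec.comp hH .fst)
        (Primrec₂.natPair.comp (Primrec.snd.comp .fst) .snd)), fun s n v hv => ?_, fun n v hv => ?_⟩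
    · obtain ⟨a, ha, hv⟩ := Option.mem_bind_iff.1 hv
      obtain ⟨b, hb, rfl⟩ := Option.mem_map.1 hv
      simp only [Seq.seq, Part.mem_bind_iff]
      exact ⟨_, Part.mem_map _ (hFA.sound _ _ _ ha), Part.mem_map _ (hHA.sound _ _ _ hb)⟩
    · simp only [Seq.seq, Part.mem_bind_iff] at hv
      obtain ⟨_, hf, hh⟩ := hv
      obtain ⟨a, ha, rfl⟩ := (Part.mem_map_iff _).1 hf
      obtain ⟨b, hb, rfl⟩ := (Part.mem_map_iff _).1 hh
      obtain ⟨s₁, h₁⟩ := hFA.complete _ _ ha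
      obtain ⟨s₂, h₂⟩ := hHA.complete _ _ hb
      refine ⟨max s₁ s₂, fun s hs => Option.mem_bind_iff.2 ⟨a, h₁ s (le_of_max_le_left hs),
        Option.mem_map.2 ⟨b, h₂ s (le_of_max_le_right hs), rfl⟩⟩⟩
  | @comp f h _ _ ihf ihh =>
    obtain ⟨F, hF, hFA⟩ := ihf
    obtain ⟨H, hH, hHA⟩ := ihh
    refine ⟨fun σ n => (H σ n).bind fun a => F σ a, Primrec.option_bind hH
      (hF.comp (Primrec.fst.comp .fst) .snd), fun s n v hv => ?_, fun n v hv => ?_⟩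
    · obtain ⟨a, ha, hv⟩ := Option.mem_bind_iff.1 hv
      exact Part.mem_bind_iff.2 ⟨a, hHA.sound _ _ _ ha, hFA.sound _ _ _ hv⟩
    · obtain ⟨a, ha, hv⟩ := Part.mem_bind_iff.1 hv
      obtain ⟨s₁, h₁⟩ := hHA.complete _ _ ha
      obtain ⟨s₂, h₂⟩ := hFA.complete _ _ hv
      exact ⟨max s₁ s₂, fun s hs => Option.mem_bind_iff.2 ⟨a, h₁ s (le_of_max_le_left hs),
        h₂ s (le_of_max_le_right hs)⟩⟩
  | @prec f h _ _ ihf ihh =>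
    obtain ⟨F, hF, hFA⟩ := ihf
    obtain ⟨H, hH, hHA⟩ := ihh
    refine ⟨fun σ p => p.unpair.2.rec (F σ p.unpair.1) fun y IH => IH.bind fun i =>
      H σ (Nat.pair p.unpair.1 (Nat.pair y i)), ?_, fun s p v hv => ?_, fun p v hv => ?_⟩
    · refine Primrec.nat_rec' (f := fun x : List Bool × ℕ => x.2.unpair.2)
        (g := fun x => F x.1 x.2.unpair.1)
        (h := fun x y => y.2.bind fun i => H x.1 (Nat.pair x.2.unpair.1 (Nat.pair y.1 i)))
        (Primrec.snd.comp (Primrec.unpair.comp .snd))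
        (hF.comp .fst (Primrec.fst.comp (Primrec.unpair.comp .snd))) ?_
      refine Primrec.option_bind (Primrec.snd.comp .snd) (hH.comp (Primrec.fst.comp
        (Primrec.fst.comp .fst)) (Primrec₂.natPair.comp ?_ (Primrec₂.natPair.comp ?_ .snd)))
      · exact Primrec.fst.comp (Primrec.unpair.comp (Primrec.snd.comp (Primrec.fst.comp .fst)))
      · exact Primrec.fst.comp (Primrec.snd.comp .fst)
    · dsimp only at hv ⊢
      generalize p.unpair.2 = n at *
      induction n generalizing v with
      | zero => exact hFA.sound _ _ _ hv
      | succ n ih =>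
        obtain ⟨i, hi, hv⟩ := Option.mem_bind_iff.1 hv
        exact Part.mem_bind_iff.2 ⟨i, ih i hi, hHA.sound _ _ _ hv⟩
    · dsimp only at hv ⊢
      generalize p.unpair.2 = n at *
      induction n generalizing v with
      | zero => exact hFA.complete _ _ hv
      | succ n ih =>
        obtain ⟨i, hi, hv⟩ := Part.mem_bind_iff.1 hv
        obtain ⟨s₁, h₁⟩ := ih i hi
        obtain ⟨s₂, h₂⟩ := hHA.complete _ _ hv
        exact ⟨max s₁ s₂, fun s hs => Option.mem_bind_iff.2 ⟨i, h₁ s (le_of_max_le_left hs),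
          h₂ s (le_of_max_le_right hs)⟩⟩
  | @rfind f _ ihf =>
    obtain ⟨F, hF, hFA⟩ := ihf
    have hG : PrimrecRel fun (x : List Bool × ℕ) (r : ℕ) => F x.1 (Nat.pair x.2 r) = some 0 ∧
        ∀ k < r, (F x.1 (Nat.pair x.2 k)).getD 0 ≠ 0 := by
      have h1 : PrimrecRel fun (k : ℕ) (x : List Bool × ℕ) =>
          (F x.1 (Nat.pair x.2 k)).getD 0 ≠ 0 :=
        PrimrecPred.not (Primrec.eq.comp (Primrec.option_getD.comp (hF.comp (Primrec.fst.comp .snd)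
          (Primrec₂.natPair.comp (Primrec.snd.comp .snd) .fst)) (.const 0)) (.const 0))
      exact PrimrecPred.and (Primrec.eq.comp (hF.comp (Primrec.fst.comp .fst)
        (Primrec₂.natPair.comp (Primrec.snd.comp .fst) .snd)) (.const (some 0)))
        (h1.forall_lt'.comp .snd .fst)
    have huniq : ∀ σ a r r', (F σ (Nat.pair a r) = some 0 ∧
        ∀ k < r, (F σ (Nat.pair a k)).getD 0 ≠ 0) → (F σ (Nat.pair a r') = some 0 ∧
        ∀ k < r', (F σ (Nat.pair a k)).getD 0 ≠ 0) → r = r' := by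
      intro σ a r r' h h'
      rcases lt_trichotomy r r' with hr | hr | hr
      · exact absurd (by rw [h.1]; rfl) (h'.2 r hr)
      · exact hr
      · exact absurd (by rw [h'.1]; rfl) (h.2 r' hr)
    -- The length of σ bounds the search, which keeps the functional primitive recursive. At most
    -- one r is a first zero with all earlier values defined and nonzero (default 0 excludes
    -- undefined ones), so the greatest such r is the least zero.
    classical
    let r₀ (σ : List Bool) (a : ℕ) : ℕ := Nat.findGreatest (fun r => F σ (Nat.pair a r) = some 0 ∧
      ∀ k < r, (F σ (Nat.pair a k)).getD 0 ≠ 0) σ.length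
    have hr₀ : Primrec fun x : List Bool × ℕ => r₀ x.1 x.2 :=
      Primrec.nat_findGreatest (Primrec.list_length.comp .fst) hG
    refine ⟨fun σ a => if F σ (Nat.pair a (r₀ σ a)) = some 0 ∧
        ∀ k < r₀ σ a, (F σ (Nat.pair a k)).getD 0 ≠ 0 then some (r₀ σ a) else none,
      Primrec.ite (hG.comp .id hr₀) (Primrec.option_some.comp hr₀) (.const none),
      fun s a v hv => ?_, fun a v hv => ?_⟩
    · split_ifs at hv with h
      · obtain rfl := Option.some.inj hv
        refine Nat.mem_rfind.2 ⟨Part.mem_map_iff _ |>.2 ⟨0, hFA.sound _ _ _ h.1, by simp⟩,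
          fun {k} hk => ?_⟩
        rcases hFk : F (initialSegment A s) (Nat.pair a k) with _ | y
        · exact absurd (by rw [hFk]; rfl) (h.2 k hk)
        · refine Part.mem_map_iff _ |>.2 ⟨y, hFA.sound _ _ _ hFk, ?_⟩
          have := h.2 k hk
          rw [hFk] at this
          simpa using this
      · cases hv
    · obtain ⟨h0, hlt⟩ := Nat.mem_rfind.1 hv
      obtain ⟨y, hy, hy0⟩ := (Part.mem_map_iff _).1 h0
      obtain rfl : y = 0 := by simpa using hy0
      obtain ⟨s₁, h₁⟩ := hFA.complete _ _ hy
      have hk : ∀ k, ∃ s₀, k < v → ∀ s ≥ s₀, (F (initialSegment A s) (Nat.pair a k)).getD 0 ≠ 0 := by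
        intro k
        by_cases hkv : k < v
        · obtain ⟨y, hy, hy0⟩ := (Part.mem_map_iff _).1 (hlt hkv)
          obtain ⟨s₀, h₀⟩ := hFA.complete _ _ hy
          refine ⟨s₀, fun _ s hs => ?_⟩
          rw [Option.mem_def.1 (h₀ s hs)]
          simpa using hy0
        · exact ⟨0, fun h => absurd h hkv⟩
      choose s₂ h₂ using hk
      -- The initial segment has to be long enough for the search to reach v, for the zero at v to
      -- be seen, and for the nonzero values at all k < v to be seen.
      refine ⟨max (max v s₁) ((Finset.range v).sup s₂), fun s hs => ?_⟩
      have hv : F (initialSegment A s) (Nat.pair a v) = some 0 ∧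
          ∀ k < v, (F (initialSegment A s) (Nat.pair a k)).getD 0 ≠ 0 :=
        ⟨h₁ s (by omega), fun k hk => h₂ k hk s
          ((Finset.le_sup (f := s₂) (Finset.mem_range.2 hk)).trans (le_of_max_le_right hs))⟩
      have hlen : v ≤ (initialSegment A s).length := by
        rw [initialSegment, List.length_map, List.length_range]; omega
      have hspec := Nat.findGreatest_spec (P := fun r =>
        F (initialSegment A s) (Nat.pair a r) = some 0 ∧
          ∀ k < r, (F (initialSegment A s) (Nat.pair a k)).getD 0 ≠ 0) hlen hv
      have e : r₀ (initialSegment A s) a = v := huniq _ _ _ _ hspec hv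
      rw [e, if_pos hv]
      rfl

/-! ### A universal function for the primitive recursive functions -/

namespace Nat.Partrec.Code

/-- Whether a code does not use unbounded search. -/
def searchFree : Code → Bool
  | rfind' _ => false
  | pair a b | comp a b | prec a b => a.searchFree && b.searchFree
  | _ => true

theorem primrec_searchFree : Primrec searchFree := by
  have h : Primrec fun a : Code × Code × Code × Bool × Bool => a.2.2.2.1 && a.2.2.2.2 :=
    Primrec.and.comp (Primrec.fst.comp (Primrec.snd.comp (Primrec.snd.comp .snd)))
      (Primrec.snd.comp (Primrec.snd.comp (Primrec.snd.comp .snd)))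
  refine (primrec_recOn (c := id) .id (.const true) (.const true) (.const true) (.const true)
    (pr := fun _ _ _ x y => x && y) h (co := fun _ _ _ x y => x && y) h
    (pc := fun _ _ _ x y => x && y) h (rf := fun _ _ _ => false) (.const false)).of_eq fun c => ?_
  induction c with
  | zero | succ | left | right | rfind' => rfl
  | pair a b iha ihb | comp a b iha ihb | prec a b iha ihb =>
    simp only [id, searchFree] at *
    rw [← iha, ← ihb]

theorem dom_of_searchFree {c : Code} (h : c.searchFree = true) (n : ℕ) : (c.eval n).Dom := by
  induction c generalizing n with
  | zero | succ | left | right => exact trivial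
  | rfind' => cases h
  | pair a b iha ihb =>
    simp only [searchFree, Bool.and_eq_true] at h
    simp only [eval, Seq.seq]
    exact ⟨iha h.1 n, ihb h.2 n⟩
  | comp a b iha ihb =>
    simp only [searchFree, Bool.and_eq_true] at h
    exact ⟨ihb h.2 n, iha h.1 _⟩
  | prec a b iha ihb =>
    simp only [searchFree, Bool.and_eq_true] at h
    simp only [eval, unpaired]
    generalize (unpair n).2 = k
    induction k with
    | zero => exact iha h.1 _
    | succ k ih => exact ⟨ih, ihb h.2 _⟩

theorem exists_searchFree {f : ℕ → ℕ} (hf : Nat.Primrec f) :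
    ∃ c : Code, c.searchFree = true ∧ ∀ n, c.eval n = Part.some (f n) := by
  induction hf with
  | zero => exact ⟨zero, rfl, fun _ => rfl⟩
  | succ => exact ⟨succ, rfl, fun _ => rfl⟩
  | left => exact ⟨left, rfl, fun _ => rfl⟩
  | right => exact ⟨right, rfl, fun _ => rfl⟩
  | pair _ _ ihf ihg =>
    obtain ⟨a, ha, ha'⟩ := ihf
    obtain ⟨b, hb, hb'⟩ := ihg
    exact ⟨pair a b, by simp [searchFree, ha, hb], fun n => by simp [eval, ha', hb', Seq.seq]⟩
  | comp _ _ ihf ihg =>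
    obtain ⟨a, ha, ha'⟩ := ihf
    obtain ⟨b, hb, hb'⟩ := ihg
    exact ⟨comp a b, by simp [searchFree, ha, hb], fun n => by
      simp only [eval, hb']
      exact (Part.bind_some _ _).trans (ha' _)⟩
  | prec _ _ ihf ihg =>
    obtain ⟨a, ha, ha'⟩ := ihf
    obtain ⟨b, hb, hb'⟩ := ihg
    refine ⟨prec a b, by simp [searchFree, ha, hb], fun n => ?_⟩
    simp only [eval, unpaired]
    generalize (unpair n).2 = k
    induction k with
    | zero => simp [ha']
    | succ k ih => simp only [ih]; simp [hb']

end Nat.Partrec.Code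

-- Diagonalization needs a list of total functions. Being free of unbounded search is decidable from
-- the code and forces totality; all other codes are assigned the zero function.
open Nat.Partrec (Code) in
theorem exists_universal_primrec : ∃ u : ℕ → ℕ → ℕ, Computable₂ u ∧
    ∀ f : ℕ → ℕ, Primrec f → ∃ i, ∀ n, u i n = f n := by
  classical
  let u (i n : ℕ) : ℕ := if h : (Denumerable.ofNat Code i).searchFree = true then
    ((Denumerable.ofNat Code i).eval n).get (Code.dom_of_searchFree h n) else 0
  refine ⟨u, ?_, fun f hf => ?_⟩
  · have hc : Computable fun p : ℕ × ℕ => (Denumerable.ofNat Code p.1).searchFree :=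
      (Code.primrec_searchFree.comp ((Primrec.ofNat Code).comp .fst)).to_comp
    have he : Partrec fun p : ℕ × ℕ => (Denumerable.ofNat Code p.1).eval p.2 :=
      Code.eval_part.comp ((Computable.ofNat Code).comp .fst) .snd
    refine (Partrec.cond hc he (Computable.const 0).partrec).of_eq_tot fun p => ?_
    by_cases h : (Denumerable.ofNat Code p.1).searchFree = true
    · simp only [u, h, dif_pos, cond_true]
      exact Part.get_mem _
    · simp only [u, h]
      simp
  · obtain ⟨c, hc, hc'⟩ := Code.exists_searchFree (Primrec.nat_iff.1 hf)
    refine ⟨Encodable.encode c, fun n => ?_⟩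
    simp only [u, Denumerable.ofNat_encode, hc, dif_pos, hc']
    simp

/-! ### Sets that compute a diagonally noncomputable function -/

theorem primrec_polynomial_eval (p : Polynomial ℕ) : Primrec fun n => p.eval n := by
  induction p using Polynomial.induction_on' with
  | add p q hp hq =>
    simp only [Polynomial.eval_add]
    exact Primrec.nat_add.comp hp hq
  | monomial n a =>
    simp only [Polynomial.eval_monomial]
    exact Primrec.nat_mul.comp (.const a) (Cmd.primrec_nat_pow.comp .id (.const n))

theorem polynomial_eval_mono (p : Polynomial ℕ) : Monotone fun n => p.eval n := by
  induction p using Polynomial.induction_on' with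
  | add p q hp hq =>
    simp only [Polynomial.eval_add]
    exact hp.add hq
  | monomial n a =>
    simp only [Polynomial.eval_monomial]
    exact fun x y h => Nat.mul_le_mul_left _ (Nat.pow_le_pow_left h n)

theorem computable_forall_lt {α : Type*} [Primcodable α] {b : α → ℕ → Bool} (hb : Computable₂ b)
    {N : α → ℕ} (hN : Computable N) : Computable fun a => decide (∀ k < N a, b a k = true) := by
  refine (Computable.nat_rec (g := fun _ => true) (h := fun a p => p.2 && b a p.1) hN (.const true)
    (Primrec.and.to_comp.comp (Computable.snd.comp .snd)
      (hb.comp .fst (Computable.fst.comp .snd)))).of_eq fun a => ?_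
  induction N a with
  | zero => simp
  | succ n ih =>
    simp only [ih, Nat.lt_succ_iff_lt_or_eq, or_imp, forall_and, forall_eq, Bool.decide_and,
      Bool.decide_eq_true]

open Nat.Partrec (Code) in
/-- For every enumeration `b` of computable functions, there is a computable set `ℓ` of numbers
`⟨⟨i, e⟩, ⟨v, t⟩⟩` such that `φ_e(e) = v` for all its elements, and which is different from the
set given by each function `b i`, where `0`, `1`, `2` mean `undefined`, `false`, `true`. -/
theorem exists_diagonal {b : ℕ → ℕ → ℕ} (hb : Computable₂ b) : ∃ ℓ : ℕ → Bool, Computable ℓ ∧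
    (∀ m, ℓ m = true → m.unpair.2.unpair.1 ∈
      (Denumerable.ofNat Code m.unpair.1.unpair.2).eval m.unpair.1.unpair.2) ∧
    ∀ i, ∃ e, ∀ j, b i (Nat.pair (Nat.pair i e) j) ≠ 0 →
      ∃ m, b i m ≠ 0 ∧ (ℓ m = true ↔ b i m = 1) := by
  let test (a k : ℕ) : Bool := decide (b a.unpair.1 (Nat.pair a k) ≠ 0)
  have hb' : Computable₂ fun a k : ℕ => b a.unpair.1 (Nat.pair a k) :=
    hb.comp (Computable.fst.comp (Computable.unpair.comp .fst)) Primrec₂.natPair.to_comp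
  have htest : Computable₂ test := by
    have := (PrimrecPred.not (Primrec.eq.comp .id (.const (0 : ℕ)))).decide.to_comp.comp hb'
    exact this
  -- For a = ⟨i, e⟩ this is the component v of the least ⟨v, t⟩ at which `b i` is defined.
  have hψ : Partrec fun a : ℕ => (Nat.rfind fun k => Part.some (test a k)).map
      fun j => j.unpair.1 :=
    (Partrec.rfind htest.partrec₂).map (Computable.fst.comp (Computable.unpair.comp .snd))
  obtain ⟨c, hc⟩ := Code.exists_code.1 (Partrec.nat_iff.1 hψ)
  -- The s-m-n theorem is enough: φ_{E(i)}(x) = ψ⟨i, x⟩ for all x, in particular for x = E(i), so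
  -- the recursion theorem is not needed.
  obtain ⟨E, hE, hEc⟩ : ∃ E : ℕ → ℕ, Computable E ∧
      ∀ i, Denumerable.ofNat Code (E i) = Code.curry c i :=
    ⟨fun i => Encodable.encode (Code.curry c i),
      (Primrec.encode.comp (Code.primrec₂_curry.comp (.const c) .id)).to_comp,
      fun i => Denumerable.ofNat_encode _⟩
  -- `ℓ` is true exactly at the least pair for i and E(i), and only if `b i` says `false` there.
  -- Minimality is a bounded check, so `ℓ` is computable although the least pair itself may not
  -- exist.
  let ℓ (m : ℕ) : Bool := decide (m.unpair.1.unpair.2 = E m.unpair.1.unpair.1) &&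
    (decide (b m.unpair.1.unpair.1 m = 1) &&
      decide (∀ k < m.unpair.2, (!test m.unpair.1 k) = true))
  have hfst : Computable fun m : ℕ => m.unpair.1 := Computable.fst.comp .unpair
  have hsnd : Computable fun m : ℕ => m.unpair.2 := Computable.snd.comp .unpair
  have hi : Computable fun m : ℕ => m.unpair.1.unpair.1 := hfst.comp hfst
  have hℓ₁ : Computable fun m : ℕ => decide (m.unpair.1.unpair.2 = E m.unpair.1.unpair.1) :=
    (Primrec.eq (α := ℕ)).decide.to_comp.comp (hsnd.comp hfst) (hE.comp hi)
  have hℓ₂ : Computable fun m : ℕ => decide (b m.unpair.1.unpair.1 m = 1) :=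
    (Primrec.eq (α := ℕ)).decide.to_comp.comp (hb.comp hi .id) (.const 1)
  have hℓ₃ : Computable₂ fun m k : ℕ => !test m.unpair.1 k :=
    Primrec.not.to_comp.comp (htest.comp (hfst.comp .fst) .snd)
  have hℓ : Computable ℓ := Primrec.and.to_comp.comp hℓ₁ (Primrec.and.to_comp.comp hℓ₂
    (computable_forall_lt hℓ₃ hsnd))
  have hℓ' : ∀ m, ℓ m = true ↔ m.unpair.1.unpair.2 = E m.unpair.1.unpair.1 ∧
      b m.unpair.1.unpair.1 m = 1 ∧
      ∀ k < m.unpair.2, b m.unpair.1.unpair.1 (Nat.pair m.unpair.1 k) = 0 := by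
    intro m
    simp [ℓ, test]
  refine ⟨ℓ, hℓ, fun m hm => ?_, fun i => ⟨E i, fun j hj => ?_⟩⟩
  · obtain ⟨he, h1, hlt⟩ := (hℓ' m).1 hm
    have hcode : Denumerable.ofNat Code m.unpair.1.unpair.2 = Code.curry c m.unpair.1.unpair.1 := by
      rw [he, hEc]
    rw [hcode, Code.eval_curry, hc, Nat.pair_unpair]
    refine Part.mem_map _ (Nat.mem_rfind.2 ⟨?_, fun {k} hk => ?_⟩)
    · simp [test, Nat.pair_unpair, h1]
    · simp [test, hlt k hk]
  · classical
    have hex : ∃ j, b i (Nat.pair (Nat.pair i (E i)) j) ≠ 0 := ⟨j, hj⟩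
    refine ⟨Nat.pair (Nat.pair i (E i)) (Nat.find hex), Nat.find_spec hex, ?_⟩
    rw [hℓ']
    simp only [Nat.unpair_pair, true_and, and_iff_left_iff_imp]
    exact fun _ k hk => not_not.1 (Nat.find_min hex hk)

theorem not_lowForSpeed_of_isDNC (c : TimeConvention) {A : ℕ → Bool} {g : ℕ → ℕ} (hg : IsDNC g)
    (hgA : totalFn g ≤ᵀ charFn A) : ¬ LowForSpeed c A := by
  intro hA
  obtain ⟨F, hF, hFA⟩ := exists_approximates (RecursiveIn.iff_nat.1 hgA)
  let R (m : ℕ) (σ : List Bool) : Bool :=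
    decide (F σ m.unpair.1.unpair.2 = some m.unpair.2.unpair.1)
  have hR : Computable₂ R := by
    refine ((Primrec.eq (α := Option ℕ)).decide.comp (hF.comp .snd ?_)
      (Primrec.option_some.comp ?_)).to_comp
    · exact Primrec.snd.comp (Primrec.unpair.comp (Primrec.fst.comp (Primrec.unpair.comp .fst)))
    · exact Primrec.fst.comp (Primrec.unpair.comp (Primrec.snd.comp (Primrec.unpair.comp .fst)))
  obtain ⟨h, hh, hfast⟩ := Cmd.exists_fast_machine
    (fun M => OracleMachine.exists_computable_bound (M := M)) hR
  obtain ⟨u, hu, hu'⟩ := exists_universal_primrec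
  -- The function h is merely computable, so h(m) is passed as data; what is listed are primitive
  -- recursive functions of ⟨m, h(m)⟩.
  obtain ⟨ℓ, hℓ, hℓφ, hdiag⟩ := exists_diagonal (b := fun i m => u i (Nat.pair m (h m)))
    (hu.comp .fst (Primrec₂.natPair.to_comp.comp .snd (hh.comp .snd)))
  -- Rejecting after a successful test is correct because `g` is DNC: the test gives v = g(e),
  -- whereas membership would give v = φ_e(e).
  obtain ⟨M, f, hM, hf⟩ := hfast ℓ hℓ A fun m hm => by
    by_contra hℓm
    rw [Bool.not_eq_false] at hℓm
    have h1 := hFA.sound _ _ _ (of_decide_eq_true hm)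
    rw [totalFn, Part.mem_some_iff] at h1
    have h2 := hℓφ m hℓm
    rw [h1] at h2
    exact hg _ h2
  have hL : ComputablePred (· ∈ {x : List Bool | (∀ b ∈ x, b = true) ∧ ℓ x.length = true}) := by
    classical
    have h1 : PrimrecPred fun x : List Bool => ∀ b ∈ x, b = true :=
      PrimrecPred.forall_mem_list (Primrec.eq.comp .id (.const true))
    refine ⟨inferInstance, (Primrec.and.to_comp.comp h1.decide.to_comp
      (hℓ.comp Computable.list_length)).of_eq fun x => ?_⟩
    simp
  obtain ⟨M', p, -, hM'⟩ := hA _ hL (fun x => f x.length)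
    (by cases c
        · trivial
        · exact ⟨f, rfl⟩) M hM
  -- The codes of `none`, `some false`, `some true` are 0, 1, 2, as `exists_diagonal` expects.
  have hrun : Primrec fun n : ℕ => Encodable.encode
      (M'.run (0 : ℕ).testBit (p.eval n.unpair.2) (M'.initial (List.replicate n.unpair.1 true))) :=
    Primrec.encode.comp (M'.primrec_run.comp ((Primrec.const 0).pair
      (((primrec_polynomial_eval p).comp (Primrec.snd.comp .unpair)).pair
        (Primrec.fst.comp .unpair))))
  have h0 : (0 : ℕ).testBit = fun _ => false := funext fun _ => Nat.zero_testBit _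
  rw [h0] at hrun
  obtain ⟨i, hi⟩ := hu' _ hrun
  obtain ⟨e, he⟩ := hdiag i
  simp only [hi, Nat.unpair_pair] at he
  obtain ⟨s, hs⟩ := hFA.complete e (g e) (Part.mem_some _)
  have hfm : ∀ m, ∃ b, M'.run (fun _ => false) (p.eval (f m))
      (M'.initial (List.replicate m true)) = some b ∧ (b = true ↔ ℓ m = true) := by
    intro m
    obtain ⟨b, hb, hb'⟩ := hM' (List.replicate m true)
    dsimp only at hb
    rw [List.length_replicate] at hb
    refine ⟨b, hb, hb'.trans ?_⟩
    simp [List.mem_replicate]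
  -- With v = g(e) and t = s the pairing gives m ≥ s, so the first m bits of `A` suffice and the
  -- test succeeds. Then f(m) ≤ h(m), and by monotonicity of p the simulation halts within p(h(m))
  -- steps.
  obtain ⟨m, hm, hm'⟩ := he (Nat.pair (g e) s) (by
    have hRm := hf (Nat.pair (Nat.pair i e) (Nat.pair (g e) s)) (by
      simp only [R, Nat.unpair_pair, decide_eq_true_eq]
      exact hs _ ((Nat.right_le_pair _ _).trans (Nat.right_le_pair _ _)))
    obtain ⟨b, hb, -⟩ := hfm (Nat.pair (Nat.pair i e) (Nat.pair (g e) s))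
    rw [OracleMachine.run_mono (polynomial_eval_mono p hRm) hb]
    cases b <;> decide)
  -- At the diagonal m the test need not succeed. The run truncated at p(h(m)) and the full run at
  -- p(f(m)) both halt, so they agree.
  obtain ⟨b, hb, hb'⟩ := hfm m
  rcases hr : M'.run (fun _ => false) (p.eval (h m)) (M'.initial (List.replicate m true)) with _ | b'
  · rw [hr] at hm
    exact hm rfl
  · rw [hr, ← hb', ← OracleMachine.run_unique hr hb] at hm'
    revert hm'
    cases b' <;> decide

/-! ### Martin-Löf random sequences compute diagonally noncomputable functions -/

section RecursiveIn

variable {O : Set (ℕ →. ℕ)} {f g : ℕ → ℕ}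

theorem recursiveIn_totalFn_of_primrec (hf : Primrec f) : Nat.RecursiveIn O (totalFn f) :=
  (Primrec.nat_iff.1 hf).recursiveIn

theorem recursiveIn_totalFn_comp (hf : Nat.RecursiveIn O (totalFn f))
    (hg : Nat.RecursiveIn O (totalFn g)) : Nat.RecursiveIn O (totalFn fun n => f (g n)) :=
  (hf.comp hg).of_eq fun _ => Part.bind_some _ _

theorem recursiveIn_totalFn_pair (hf : Nat.RecursiveIn O (totalFn f))
    (hg : Nat.RecursiveIn O (totalFn g)) : Nat.RecursiveIn O (totalFn fun n => Nat.pair (f n) (g n)) :=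
  (hf.pair hg).of_eq fun n => by simp [totalFn, Seq.seq]

theorem recursiveIn_encode_initialSegment (X : ℕ → Bool) : Nat.RecursiveIn {charFn X}
    (totalFn fun n => Encodable.encode (initialSegment X n)) := by
  have hX : Nat.RecursiveIn {charFn X} (totalFn fun n => (X n).toNat) := .oracle _ rfl
  have hy : Primrec fun n : ℕ => n.unpair.2.unpair.1 :=
    Primrec.fst.comp (Primrec.unpair.comp (Primrec.snd.comp .unpair))
  have hi : Primrec fun n : ℕ => n.unpair.2.unpair.2 :=
    Primrec.snd.comp (Primrec.unpair.comp (Primrec.snd.comp .unpair))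
  have hstep : Nat.RecursiveIn {charFn X} (totalFn fun n =>
      Cmd.appendCode n.unpair.2.unpair.2 (X n.unpair.2.unpair.1).toNat) := by
    have h1 : Primrec fun n : ℕ => Cmd.appendCode n.unpair.1 n.unpair.2 :=
      Cmd.primrec_appendCode.comp (Primrec.fst.comp .unpair) (Primrec.snd.comp .unpair)
    have := recursiveIn_totalFn_comp (recursiveIn_totalFn_of_primrec h1)
      (recursiveIn_totalFn_pair (recursiveIn_totalFn_of_primrec hi)
        (recursiveIn_totalFn_comp hX (recursiveIn_totalFn_of_primrec hy)))
    simpa only [Nat.unpair_pair] using this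
  have hp := (recursiveIn_totalFn_of_primrec (O := {charFn X}) (Primrec.const 0)).prec hstep
  refine (hp.comp (recursiveIn_totalFn_of_primrec
    (Primrec₂.natPair.comp (.const 0) .id))).of_eq fun n => ?_
  refine (Part.bind_some _ _).trans ?_
  simp only [Nat.unpair_pair, id, totalFn]
  induction n with
  | zero => rfl
  | succ n ih =>
    simp only [ih]
    refine (Part.bind_some _ _).trans ?_
    rw [initialSegment_succ]
    simp only [Cmd.appendCode, Encodable.encodek, Option.getD_some]
    cases X n <;> rfl

end RecursiveIn

/-- A diagonally noncomputable function with values `0` and `1`. -/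
theorem exists_isDNC : ∃ B : ℕ → Bool, IsDNC fun e => (B e).toNat := by
  classical
  refine ⟨fun e => decide (0 ∈ (Denumerable.ofNat Nat.Partrec.Code e).eval e), fun e he => ?_⟩
  dsimp only at he
  by_cases h : 0 ∈ (Denumerable.ofNat Nat.Partrec.Code e).eval e
  · simp only [h, decide_true, Bool.toNat_true] at he
    cases Part.mem_unique he h
  · simp only [h, decide_false, Bool.toNat_false] at he

theorem mem_cylinder_initialSegment (X : ℕ → Bool) (n : ℕ) : X ∈ cylinder (initialSegment X n) := by
  intro i hi
  simp [initialSegment]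

theorem coinMeasure_cylinder (σ : List Bool) : coinMeasure (cylinder σ) = 2⁻¹ ^ σ.length := by
  have h : cylinder σ = Set.pi (Finset.range σ.length) fun i => {σ.getD i false} := by
    ext X
    simp only [cylinder, Set.mem_ofPred_eq, Set.mem_pi, Finset.coe_range, Set.mem_Iio,
      Set.mem_singleton_iff]
    refine forall₂_congr fun i hi => ?_
    rw [List.getD_eq_getElem _ _ hi]
  have : MeasureTheory.IsProbabilityMeasure
      (ProbabilityTheory.uniformOn (Set.univ : Set Bool)) :=
    ProbabilityTheory.isProbabilityMeasure_uniformOn Set.finite_univ Set.univ_nonempty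
  rw [h, coinMeasure, MeasureTheory.Measure.infinitePi_pi _ (fun i _ => MeasurableSet.singleton _)]
  have hb : ∀ b : Bool, ProbabilityTheory.uniformOn Set.univ {b} = (2⁻¹ : ENNReal) := fun b => by
    rw [ProbabilityTheory.uniformOn_univ]
    simp
  simp only [hb, Finset.prod_const, Finset.card_range]

open Nat.Partrec (Code) in
/-- The test for initial segments of length `e + 1` with code `φ_e(e)`, where `e ≥ n`. -/
def diagonalTest (n : ℕ) : Set (List Bool) :=
  {σ | ∃ e ≥ n, σ.length = e + 1 ∧ Encodable.encode σ ∈ (Denumerable.ofNat Code e).eval e}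

-- For each e at most one string is the one coded by φ_e(e), since φ_e(e) has at most one value and
-- coding is injective. It contributes measure at most 2^-(e+1), and summing over e ≥ n gives 2^-n.
open Nat.Partrec (Code) in
theorem isMLTest_diagonalTest : IsMLTest diagonalTest := by
  refine ⟨?_, fun n => ?_⟩
  · have hlen : Computable fun p : ℕ × List Bool => p.2.length - 1 :=
      (Primrec.pred.comp (Primrec.list_length.comp .snd)).to_comp
    have hev : Partrec fun p : ℕ × List Bool =>
        (Denumerable.ofNat Code (p.2.length - 1)).eval (p.2.length - 1) :=
      Code.eval_part.comp ((Computable.ofNat Code).comp hlen) hlen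
    have hc : Computable₂ fun (p : ℕ × List Bool) (v : ℕ) =>
        decide (p.1 < p.2.length) && decide (v = Encodable.encode p.2) :=
      (Primrec.and.comp (Primrec.nat_lt.decide.comp (Primrec.fst.comp .fst)
        (Primrec.list_length.comp (Primrec.snd.comp .fst)))
        ((Primrec.eq (α := ℕ)).decide.comp .snd (Primrec.encode.comp (Primrec.snd.comp .fst)))).to_comp
    have hg : Partrec₂ fun (p : ℕ × List Bool) (v : ℕ) =>
        bif decide (p.1 < p.2.length) && decide (v = Encodable.encode p.2)
          then Part.some () else Part.none :=
      Partrec.cond hc (Computable.const ()).partrec Partrec.none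
    refine (hev.bind hg).dom_re.of_eq fun p => ?_
    obtain ⟨n, σ⟩ := p
    simp only [Part.dom_iff_mem, Part.mem_bind_iff, diagonalTest, Set.mem_ofPred_eq]
    constructor
    · rintro ⟨_, v, hv, hx⟩
      rcases hd : decide (n < σ.length) && decide (v = Encodable.encode σ) with _ | _
      · rw [hd] at hx
        exact absurd hx (Part.notMem_none _)
      · simp only [Bool.and_eq_true, decide_eq_true_eq] at hd
        exact ⟨σ.length - 1, by omega, by omega, hd.2 ▸ hv⟩
    · rintro ⟨e, he, hl, hv⟩
      refine ⟨(), Encodable.encode σ, by rw [hl]; exact hv, ?_⟩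
      have : n < σ.length := by omega
      simp [this]
  · let V (e : ℕ) : Set (ℕ → Bool) := ⋃ σ ∈ {σ : List Bool | σ.length = e + 1 ∧
      Encodable.encode σ ∈ (Denumerable.ofNat Code e).eval e}, cylinder σ
    have hV : ∀ e, coinMeasure (V e) ≤ 2⁻¹ ^ (e + 1) := by
      intro e
      by_cases h : ∃ σ : List Bool, σ.length = e + 1 ∧
        Encodable.encode σ ∈ (Denumerable.ofNat Code e).eval e
      · obtain ⟨σ, hσ, hσ'⟩ := h
        have : V e ⊆ cylinder σ := Set.iUnion₂_subset fun τ hτ => by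
          rw [Encodable.encode_injective (Part.mem_unique hτ.2 hσ')]
        refine (MeasureTheory.measure_mono this).trans_eq ?_
        rw [coinMeasure_cylinder, hσ]
      · have : V e ⊆ ∅ := Set.iUnion₂_subset fun τ hτ => absurd ⟨τ, hτ⟩ h
        refine (MeasureTheory.measure_mono this).trans ?_
        simp
    have hsub : ⋃ σ ∈ diagonalTest n, cylinder σ ⊆ ⋃ k, V (n + k) := by
      refine Set.iUnion₂_subset fun σ hσ => ?_
      obtain ⟨e, he, hσ⟩ := hσ
      obtain ⟨k, rfl⟩ := Nat.exists_eq_add_of_le he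
      exact (Set.subset_biUnion_of_mem (u := cylinder) (x := σ) hσ).trans
        (Set.subset_iUnion (fun k => V (n + k)) k)
    calc coinMeasure (⋃ σ ∈ diagonalTest n, cylinder σ)
        ≤ ∑' k, coinMeasure (V (n + k)) :=
          (MeasureTheory.measure_mono hsub).trans (MeasureTheory.measure_iUnion_le _)
      _ ≤ ∑' k, 2⁻¹ ^ (n + 1) * 2⁻¹ ^ k := ENNReal.tsum_le_tsum fun k => (hV _).trans_eq (by
          rw [← pow_add, Nat.add_right_comm])
      _ = 2⁻¹ ^ n := by
          rw [ENNReal.tsum_mul_left, ENNReal.tsum_geometric, ENNReal.one_sub_inv_two, inv_inv,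
            pow_succ, mul_assoc, ENNReal.inv_mul_cancel (by simp) (by simp), mul_one]

open Nat.Partrec (Code) in
theorem MLRandom.exists_isDNC {X : ℕ → Bool} (hX : MLRandom X) :
    ∃ g : ℕ → ℕ, IsDNC g ∧ totalFn g ≤ᵀ charFn X := by
  have h := hX _ isMLTest_diagonalTest
  simp only [Set.mem_iInter, not_forall, Set.mem_iUnion, not_exists] at h
  obtain ⟨n, hn⟩ := h
  obtain ⟨B, hB⟩ := _root_.exists_isDNC
  -- Since X escapes the n-th component of the test, the codes of its initial segments are correct
  -- for e ≥ n. The finitely many earlier values come from a table of a fixed DNC function.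
  let G (e v : ℕ) : ℕ := if e < n then ((List.range n).map fun e => (B e).toNat).getD e 0 else v
  have hG : Primrec fun p : ℕ => G p.unpair.1 p.unpair.2 := by
    refine Primrec.ite (Primrec.nat_lt.comp (Primrec.fst.comp .unpair) (.const n)) ?_
      (Primrec.snd.comp .unpair)
    exact (Primrec.list_getD 0).comp (.const _) (Primrec.fst.comp .unpair)
  refine ⟨fun e => G e (Encodable.encode (initialSegment X (e + 1))), fun e he => ?_,
    RecursiveIn.iff_nat.2 ?_⟩
  · dsimp only at he
    by_cases hen : e < n
    · have : G e (Encodable.encode (initialSegment X (e + 1))) = (B e).toNat := by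
        simp only [G, if_pos hen]
        rw [List.getD_eq_getElem _ _ (by simpa using hen)]
        simp
      rw [this] at he
      exact hB e he
    · simp only [G, if_neg hen] at he
      exact hn _ ⟨e, not_lt.1 hen, by simp [initialSegment], he⟩ (mem_cylinder_initialSegment X _)
  · have := recursiveIn_totalFn_comp (recursiveIn_totalFn_of_primrec hG)
      (recursiveIn_totalFn_pair (recursiveIn_totalFn_of_primrec .id)
        (recursiveIn_totalFn_comp (recursiveIn_encode_initialSegment X)
          (recursiveIn_totalFn_of_primrec .succ)))
    simpa only [Nat.unpair_pair, id] using this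

/-! ### Passing to degrees and assembling the theorem -/

theorem IsDNCDegree.notMem_lfsDegrees (c : TimeConvention) {a : TuringDegree} (ha : IsDNCDegree a) :
    a ∉ lfsDegrees c := by
  rintro ⟨A, hA, rfl⟩
  obtain ⟨g, hg, hgA⟩ := ha
  exact not_lowForSpeed_of_isDNC c hg ((degree_le_degree_iff _ _).1 hgA) hA

theorem mainTheorem2 (c : TimeConvention) :
    -- a set that computes a DNC function is not low for speed
    (∀ (A : ℕ → Bool) (g : ℕ → ℕ), IsDNC g → totalFn g ≤ᵀ charFn A → ¬ LowForSpeed c A) ∧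
    -- no DNC degree contains a low for speed set
    (∀ a : TuringDegree, IsDNCDegree a → a ∉ lfsDegrees c) ∧
    -- low for speed sets, and their degrees, avoid a Turing upper cone
    (∃ B : ℕ → Bool,
      (∀ A : ℕ → Bool, charFn B ≤ᵀ charFn A → ¬ LowForSpeed c A) ∧
      (∀ a : TuringDegree, degree (charFn B) ≤ a → a ∉ lfsDegrees c)) ∧
    -- a set, or degree, that computes a Martin-Löf random is not low for speed
    (∀ A X : ℕ → Bool, MLRandom X → charFn X ≤ᵀ charFn A → ¬ LowForSpeed c A) ∧
    (∀ (a : TuringDegree) (X : ℕ → Bool), MLRandom X → degree (charFn X) ≤ a →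
      a ∉ lfsDegrees c) := by
  refine ⟨fun A g hg hgA => not_lowForSpeed_of_isDNC c hg hgA,
    fun a ha => ha.notMem_lfsDegrees c, ?_, fun A X hX hXA => ?_, fun a X hX hXa => ?_⟩
  · obtain ⟨B, hB⟩ := exists_isDNC
    exact ⟨B, fun A hA => not_lowForSpeed_of_isDNC c hB hA,
      fun a ha => IsDNCDegree.notMem_lfsDegrees c ⟨_, hB, ha⟩⟩
  · obtain ⟨g, hg, hgX⟩ := hX.exists_isDNC
    exact not_lowForSpeed_of_isDNC c hg (hgX.trans hXA)
  · obtain ⟨g, hg, hgX⟩ := hX.exists_isDNC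
    exact IsDNCDegree.notMem_lfsDegrees c
      ⟨g, hg, ((degree_le_degree_iff _ _).2 hgX).trans hXa⟩
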